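/- Let $\rho:M\to N$ be a smooth principal bundle whose structure group $G$ is a connected abelian Lie group (manifolds are finite-dimensional, Hausdorff, second countable and without boundary). Let $X_1,\dots,X_k$ be the vertical vector fields on $M$ generated by elements $\xi_1,\dots,\xi_k$ spanning the Lie algebra of $G$, and let $X_0$ be a smooth vector field on $M$. For $\varepsilon>0$ consider the control system $$\dot x(t)=\varepsilon X_0(x(t))+\sum_{i=1}^k u_i(t)X_i(x(t)),\qquad t\in[0,1],\qquad(\ast_\varepsilon)$$ whose admissible pairs $(x(\cdot),u(\cdot))$ consist of a bounded measurable control $u:[0,1]\to\mathbb R^k$ and a Lipschitz curve $x$ satisfying $(\ast_\varepsilon)$ almost everywhere. An admissible pair is called singular if its control is a critical point of the endpoint map $u(\cdot)\mapsto x(1)$ with fixed initial point $x(0)$. For a smooth Lagrangian $L:M\times\mathbb R^k\to\mathbb R$ let $c(y_0,y_1)$ be the infimum of $\int_0^1L(x(t),u(t))\,dt$ over the admissible pairs with $x(0)=y_0$, $x(1)=y_1$ ($+\infty$ if there are none). An optimal Borel map from $\mu$ to $\nu$ is a Borel map $\Psi:M\to M$ with $\Psi_*\mu=\nu$ whose cost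 $\int_M c(y,\Psi(y))\,d\mu(y)$ is less than $+\infty$ and is minimal among all Borel maps pushing $\mu$ forward to $\nu$. Define $H:T^*N\to\mathbb R$ by $H(p)=\max\{p(d\rho(X_0(y))) : y\in\rho^{-1}(x)\}$ for $p\in T_x^*N$. Assume that this maximum is attained for every $p\in T^*N$ and that $H$ is bounded above on compact subsets of $T^*N$ (this is automatic if $G$ is compact). Let $\mathcal D$ be the set of all $p\in T^*N$ such that $H(p)>0$ and $H$ is of class $C^2$ near $p$. For $a\in C^2(N)$ put $\Phi_a^\varepsilon(x)=\pi(e^{\varepsilon\vec H}(d_xa))$, where $\pi:T^*N\to N$ is the projection and $e^{t\vec H}$ is the Hamiltonian flow of $H$. Let $K\subset N$ be compact and let $a\in C^2(N)$ satisfy $d_xa\in\mathcal D$ for all $x\in K$. Then there is $\varepsilon_0>0$ such that for every $\varepsilon\in(0,\varepsilon_0)$ the flow $e^{t\vec H}(d_xa)$, $0\le t\le\varepsilon$, is defined for every $x\in K$, and the following holds for all Borel probability measures $\mu,\nu$ on $M$ with $\operatorname{supp}(\rho_*\mu)\subset K$ and $\rho_*\nu=(\Phi_a^\varepsilon)_*(\rho_*\mu)$,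 every smooth Lagrangian $L$, and every optimal Borel map $\Psi$ from $\mu$ to $\nu$ for the system $(\ast_\varepsilon)$ and $L$: $$\rho\circ\Psi=\Phi_a^\varepsilon\circ\rho\qquad\mu\text{-almost everywhere};$$ moreover, for $\mu$-almost every $y$ the points $y$ and $\Psi(y)$ are joined by an admissible pair of $(\ast_\varepsilon)$, and every admissible pair of $(\ast_\varepsilon)$ joining $y$ to $\Psi(y)$ is singular. -/

import Mathlib

open Set Filter Topology Manifold MeasureTheory Bundle
open scoped ContDiff ENNReal NNReal

noncomputable section

/-! ## The cotangent bundle and Hamiltonian trajectories -/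

section Cotangent

variable (E : Type*) [NormedAddCommGroup E] [NormedSpace ℝ E]
  (N : Type*) [TopologicalSpace N] [ChartedSpace E N] [IsManifold 𝓘(ℝ, E) ∞ N]

/-- The cotangent bundle `T*N`, with the manifold structure that Mathlib gives to the bundle of
continuous linear maps from the tangent bundle to the trivial line bundle. The preferred charts are
the canonical coordinates `(q, p)` induced by the preferred charts of `N`. -/
abbrev Cotangent : Type _ :=
  TotalSpace (E →L[ℝ] ℝ) (fun x : N ↦ TangentSpace 𝓘(ℝ, E) x →L[ℝ] Bundle.Trivial N ℝ x)

/-- The model with corners of the cotangent bundle. -/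
abbrev cotangentModel : ModelWithCorners ℝ (E × (E →L[ℝ] ℝ)) (ModelProd E (E →L[ℝ] ℝ)) :=
  (𝓘(ℝ, E)).prod 𝓘(ℝ, E →L[ℝ] ℝ)

variable {E N}

/-- The covector `d_x a`, as a point of the cotangent bundle. -/
def differentialAt (a : N → ℝ) (x : N) : Cotangent E N :=
  ⟨x, mfderiv 𝓘(ℝ, E) 𝓘(ℝ, ℝ) a x⟩

/-- `H` is of class `C²` at `p` (that is, on a neighbourhood of `p`). -/
def IsC2At (H : Cotangent E N → ℝ) (p : Cotangent E N) : Prop :=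
  ContMDiffAt (cotangentModel E) 𝓘(ℝ, ℝ) 2 H p

/-- The set of covectors at which `H` is positive and of class `C²`. -/
def positiveC2Region (H : Cotangent E N → ℝ) : Set (Cotangent E N) :=
  {p | 0 < H p ∧ IsC2At H p}

/-- The canonical symplectic form `∑ dpᵢ ∧ dqᵢ` of the cotangent bundle at `p`, up to the sign that
makes `q' = ∂H/∂p`, `p' = -∂H/∂q` the equation `dH = canonicalForm (Hamiltonian vector)`. A tangent
vector at `p` is written in the canonical coordinates around `p` as a pair `(q', p')`. -/
def canonicalForm (p : Cotangent E N) (V W : TangentSpace (cotangentModel E) p) : ℝ :=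
  let v : E × (E →L[ℝ] ℝ) := V
  let w : E × (E →L[ℝ] ℝ) := W
  w.2 v.1 - v.2 w.1

/-- `V` is the value at `p` of the Hamiltonian vector field of `H`. -/
def IsHamiltonianVector (H : Cotangent E N → ℝ) (p : Cotangent E N)
    (V : TangentSpace (cotangentModel E) p) : Prop :=
  ∀ W : TangentSpace (cotangentModel E) p,
    (mfderiv (cotangentModel E) 𝓘(ℝ, ℝ) H p W : ℝ) = canonicalForm p V W

/-- `γ` restricted to `[0, τ]` is a trajectory of the Hamiltonian vector field of `H`, inside the
open set where `H` is of class `C²`. -/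
def IsHamiltonianTrajectory (H : Cotangent E N → ℝ) (τ : ℝ) (γ : ℝ → Cotangent E N) : Prop :=
  ∀ t ∈ Icc 0 τ, IsC2At H (γ t) ∧
    ∃ V : TangentSpace (cotangentModel E) (γ t), IsHamiltonianVector H (γ t) V ∧
      HasMFDerivWithinAt 𝓘(ℝ, ℝ) (cotangentModel E) γ (Icc 0 τ) t
        ((1 : ℝ →L[ℝ] ℝ).smulRight V)

/-- The Hamiltonian flow of `H` starting from `p` is defined up to time `τ`. -/
def FlowDefined (H : Cotangent E N → ℝ) (τ : ℝ) (p : Cotangent E N) : Prop :=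
  ∃ γ : ℝ → Cotangent E N, IsHamiltonianTrajectory H τ γ ∧ γ 0 = p

open Classical in
/-- The Hamiltonian flow `e^{τH}(p)` (with the value `p` where it is not defined). -/
def hamiltonianFlow (H : Cotangent E N → ℝ) (τ : ℝ) (p : Cotangent E N) : Cotangent E N :=
  if h : FlowDefined H τ p then h.choose τ else p

/-- The map `x ↦ π(e^{εH}(d_x a))`. -/
def flowMap (H : Cotangent E N → ℝ) (a : N → ℝ) (ε : ℝ) (x : N) : N :=
  (hamiltonianFlow H ε (differentialAt (E := E) a x)).proj

end Cotangent

/-! ## Principal bundles -/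

section Principal

variable (EM EG EN : Type*) [NormedAddCommGroup EM] [NormedSpace ℝ EM]
  [NormedAddCommGroup EG] [NormedSpace ℝ EG] [NormedAddCommGroup EN] [NormedSpace ℝ EN]
  {M : Type*} [TopologicalSpace M] [ChartedSpace EM M]
  (G : Type*) [TopologicalSpace G] [ChartedSpace EG G] [CommGroup G] [MulAction G M]
  {N : Type*} [TopologicalSpace N] [ChartedSpace EN N]

/-- `ρ : M → N` is a smooth principal bundle with structure group `G` (abelian, so that left and
right actions need not be distinguished). -/
structure IsPrincipalBundle (ρ : M → N) : Prop where
  contMDiff_smul : ContMDiff ((𝓘(ℝ, EG)).prod 𝓘(ℝ, EM)) 𝓘(ℝ, EM) ∞ (fun q : G × M ↦ q.1 • q.2)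
  contMDiff_proj : ContMDiff 𝓘(ℝ, EM) 𝓘(ℝ, EN) ∞ ρ
  proj_smul : ∀ (g : G) (y : M), ρ (g • y) = ρ y
  locally_trivial : ∀ x : N, ∃ e : Trivialization G ρ, x ∈ e.baseSet ∧
    ContMDiffOn 𝓘(ℝ, EM) ((𝓘(ℝ, EN)).prod 𝓘(ℝ, EG)) ∞ e e.source ∧
    ContMDiffOn ((𝓘(ℝ, EN)).prod 𝓘(ℝ, EG)) 𝓘(ℝ, EM) ∞ e.toOpenPartialHomeomorph.symm e.target ∧
    ∀ (g : G), ∀ y ∈ e.source, e (g • y) = ((e y).1, g * (e y).2)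

variable {EM EG G}

/-- The vertical vector field on `M` generated by an element `ξ` of the Lie algebra of `G`: the
derivative of `g ↦ g • y` at the identity in the direction `ξ`. -/
def fundamentalField (ξ : TangentSpace 𝓘(ℝ, EG) (1 : G)) (y : M) : TangentSpace 𝓘(ℝ, EM) y :=
  (mfderiv 𝓘(ℝ, EG) 𝓘(ℝ, EM) (fun g : G ↦ g • y) 1 ξ : EM)

end Principal

section Reduced

variable {EM EN : Type*} [NormedAddCommGroup EM] [NormedSpace ℝ EM]
  [NormedAddCommGroup EN] [NormedSpace ℝ EN]
  {M : Type*} [TopologicalSpace M] [ChartedSpace EM M]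
  {N : Type*} [TopologicalSpace N] [ChartedSpace EN N] [IsManifold 𝓘(ℝ, EN) ∞ N]

/-- The set of the numbers `p (dρ (X₀ y))`, where `y` ranges over the fibre over the base point
of the covector `p`. -/
def fibreValues (ρ : M → N) (X₀ : ∀ y : M, TangentSpace 𝓘(ℝ, EM) y) (p : Cotangent EN N) :
    Set ℝ :=
  {r | ∃ (y : M) (h : ρ y = p.proj),
    r = p.2 (h ▸ (mfderiv 𝓘(ℝ, EM) 𝓘(ℝ, EN) ρ y (X₀ y) : TangentSpace 𝓘(ℝ, EN) (ρ y)))}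

/-- The Hamiltonian `H(p) = max { p (dρ (X₀ y)) | y in the fibre }` of the time-optimal problem for
the reduced system `x' = dρ (X₀ y)`, `ρ y = x`. -/
def reducedHamiltonian (ρ : M → N) (X₀ : ∀ y : M, TangentSpace 𝓘(ℝ, EM) y)
    (p : Cotangent EN N) : ℝ :=
  sSup (fibreValues ρ X₀ p)

end Reduced

/-! ## Control systems, singular trajectories, optimal control cost -/

section Control

variable {EM : Type*} [NormedAddCommGroup EM] [NormedSpace ℝ EM]
  {M : Type*} [TopologicalSpace M] [ChartedSpace EM M] {k : ℕ}

/-- The right-hand side `ε X₀ + ∑ uᵢ Xᵢ` of the rescaled control-affine system. -/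
def rescaledSystem (X₀ : ∀ y : M, TangentSpace 𝓘(ℝ, EM) y)
    (X : Fin k → ∀ y : M, TangentSpace 𝓘(ℝ, EM) y) (ε : ℝ)
    (y : M) (u : EuclideanSpace ℝ (Fin k)) : TangentSpace 𝓘(ℝ, EM) y :=
  ε • X₀ y + ∑ i, u i • X i y

/-- Admissible controls on `[0, 1]`: bounded and measurable (values outside `[0, 1]` are
irrelevant). -/
def IsAdmissibleControl (u : ℝ → EuclideanSpace ℝ (Fin k)) : Prop :=
  Measurable u ∧ ∃ R : ℝ, ∀ t ∈ Icc (0 : ℝ) 1, ‖u t‖ ≤ R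

/-- `γ` restricted to `[0, 1]` is a Lipschitz curve: it is continuous, and Lipschitz near each time
when read in a chart. -/
def IsLipschitzCurve (γ : ℝ → M) : Prop :=
  ContinuousOn γ (Icc 0 1) ∧ ∀ t ∈ Icc (0 : ℝ) 1, ∃ C : ℝ≥0, ∃ s ∈ 𝓝[Icc 0 1] t,
    LipschitzOnWith C (fun τ ↦ extChartAt 𝓘(ℝ, EM) (γ t) (γ τ)) s

/-- `(γ, u)` is an admissible pair on `[0, 1]` of the control system `γ' = F (γ, u)`. -/
structure IsAdmissiblePair
    (F : ∀ y : M, EuclideanSpace ℝ (Fin k) → TangentSpace 𝓘(ℝ, EM) y)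
    (γ : ℝ → M) (u : ℝ → EuclideanSpace ℝ (Fin k)) : Prop where
  control : IsAdmissibleControl u
  lipschitz : IsLipschitzCurve (EM := EM) γ
  ode : ∀ᵐ t ∂(volume.restrict (Icc (0 : ℝ) 1)),
    HasMFDerivAt 𝓘(ℝ, ℝ) 𝓘(ℝ, EM) γ t ((1 : ℝ →L[ℝ] ℝ).smulRight (F (γ t) (u t)))

/-- The image of the differential at `u` of the endpoint map `u ↦ γ_u(1)`, where `γ_u` is the
admissible path with control `u` and the fixed initial point `γ 0`: the derivatives at `s = 0` of
the endpoints of the admissible paths with controls `u + s v`, for all admissible `v`. -/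
def endpointVariations
    (F : ∀ y : M, EuclideanSpace ℝ (Fin k) → TangentSpace 𝓘(ℝ, EM) y)
    (γ : ℝ → M) (u : ℝ → EuclideanSpace ℝ (Fin k)) : Set (TangentSpace 𝓘(ℝ, EM) (γ 1)) :=
  {w | ∃ (v : ℝ → EuclideanSpace ℝ (Fin k)) (Γ : ℝ → ℝ → M), IsAdmissibleControl v ∧ Γ 0 = γ ∧
    (∀ᶠ s in 𝓝 (0 : ℝ), IsAdmissiblePair F (Γ s) (fun t ↦ u t + s • v t) ∧ Γ s 0 = γ 0) ∧
    HasMFDerivAt 𝓘(ℝ, ℝ) 𝓘(ℝ, EM) (fun s ↦ Γ s 1) 0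
      ((1 : ℝ →L[ℝ] ℝ).smulRight (w : EM))}

/-- The admissible pair `(γ, u)` is singular: `u` is a critical point of the endpoint map, i.e. the
differential of the endpoint map at `u` is not surjective. -/
def IsSingular
    (F : ∀ y : M, EuclideanSpace ℝ (Fin k) → TangentSpace 𝓘(ℝ, EM) y)
    (γ : ℝ → M) (u : ℝ → EuclideanSpace ℝ (Fin k)) : Prop :=
  Submodule.span ℝ (endpointVariations F γ u) ≠ ⊤

/-- The optimal control cost: the infimum of `∫₀¹ L(γ(t), u(t)) dt` over all the admissible pairs
with `γ 0 = y₀` and `γ 1 = y₁`; it is `+∞` if there are none. -/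
def controlCost
    (F : ∀ y : M, EuclideanSpace ℝ (Fin k) → TangentSpace 𝓘(ℝ, EM) y)
    (L : M × EuclideanSpace ℝ (Fin k) → ℝ) (y₀ y₁ : M) : EReal :=
  ⨅ (γ : ℝ → M) (u : ℝ → EuclideanSpace ℝ (Fin k))
    (_ : IsAdmissiblePair F γ u ∧ γ 0 = y₀ ∧ γ 1 = y₁),
    ((∫ t in (0 : ℝ)..1, L (γ t, u t) : ℝ) : EReal)

end Control

/-! ## Optimal maps -/

section Transport

variable {M : Type*} [MeasurableSpace M]

/-- The integral of the positive part of `f`, as an upper integral. -/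
def positiveIntegral (μ : Measure M) (f : M → EReal) : ℝ≥0∞ :=
  ⨅ (g : M → ℝ≥0∞) (_ : Measurable g ∧ ∀ x, (f x).toENNReal ≤ g x), ∫⁻ x, g x ∂μ

open Classical in
/-- The total cost `∫ c(x, φ(x)) dμ(x)`, with values in `[-∞, +∞]`. If the integral of the positive
part is infinite, the total cost is `+∞`. -/
def totalCost (c : M → M → EReal) (μ : Measure M) (φ : M → M) : EReal :=
  if positiveIntegral μ (fun x ↦ c x (φ x)) = ⊤ then ⊤
  else (positiveIntegral μ (fun x ↦ c x (φ x)) : EReal) -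
    ((∫⁻ x, (-(c x (φ x))).toENNReal ∂μ : ℝ≥0∞) : EReal)

/-- `Ψ` is an optimal Borel map from `μ` to `ν` for the cost `c`: it pushes `μ` forward to `ν`, its
total cost is less than `+∞`, and it minimizes the total cost among all such Borel maps. -/
structure IsOptimalMap (c : M → M → EReal) (μ ν : Measure M) (Ψ : M → M) : Prop where
  measurable : Measurable Ψ
  map_eq : μ.map Ψ = ν
  cost_lt_top : totalCost c μ Ψ < ⊤
  le_cost : ∀ φ : M → M, Measurable φ → μ.map φ = ν → totalCost c μ Ψ ≤ totalCost c μ φ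

end Transport

end

set_option autoImplicit false
set_option synthInstance.maxHeartbeats 200000

noncomputable section

/-! ## Locally Lipschitz functions of a real variable -/

section Lipschitz

/-! The controlled directions are vertical, so the projection to `N` of an admissible trajectory
moves with velocity `ε dρ(X₀)`, whatever the control
(`IsPrincipalBundle.chartDeriv_rescaledSystem`). For each base point, `H` is the support function of
the set of these velocities (before scaling by `ε`): it is sublinear in the momentum, and a covector
`l` takes at most the value `ε H(l)` on a velocity. The whole problem is thereby reduced to curves
in `N` dominated by `ε H`.

For such curves `a` acts as the initial datum of the Hamilton-Jacobi equation `S_t + H(dS) = 0`,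
whose solutions do not increase along dominated curves. Instead of solving the equation,
`exists_verification_function` builds, for each characteristic, a concave paraboloid moving along
it. By Euler's identity its value at the moving point is constant. It starts below `a`, strictly
away from the starting point `y` of the characteristic, and its opening grows fast enough to make it
a subsolution. Hence its final shape `φ` satisfies `φ(end) ≤ a(start)` along every nearby dominated
curve, with equality only if the curve starts at `y`, while `φ(Φ(y)) = a(y)` for the flow map `Φ`.

These inequalities are local. For small `ε` admissible projections stay near their starting points
(`exists_confinement`), because an upper bound for `H` on compact sets bounds the velocities.
Distant starting points therefore cannot interact, and compactness of `K × K` gives one `ε₀`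
(`exists_characteristicOptimality`). The conclusion is that `Φ` is injective and continuous on `K`,
and that an admissible curve projecting from `x` to `Φ(y)` forces `a(y) ≤ a(x)`, with equality only
if `x = y`.

Finite cost gives, for almost every `y`, an admissible pair from `y` to `Ψ(y)`. With `b = a ∘ Φ⁻¹`
on `Φ(K)`, this yields `b(ρ(Ψ y)) ≤ a(ρ y)`. The marginal condition makes both sides have the same
integral, so equality holds almost everywhere and `ρ ∘ Ψ = Φ ∘ ρ` (`ae_eq_of_potential`). Any
admissible pair joining `y` to `Ψ(y)` then maximizes `φ ∘ ρ` at its endpoint. Since `dφ` there is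
the final momentum, nonzero near the region `H > 0`, and `ρ` is a submersion, the endpoint map is
critical (`isSingular_of_forall_le`). -/

theorem exists_lipschitzOnWith_comp_contDiffAt {A E F : Type*} [PseudoEMetricSpace A]
    [NormedAddCommGroup E] [NormedSpace ℝ E] [NormedAddCommGroup F] [NormedSpace ℝ F]
    {f : A → E} {s : Set A} {x : A} (hx : x ∈ s)
    (hf : ∃ C : ℝ≥0, ∃ t ∈ 𝓝[s] x, LipschitzOnWith C f t) {g : E → F}
    (hg : ContDiffAt ℝ 1 g (f x)) :
    ∃ C : ℝ≥0, ∃ t ∈ 𝓝[s] x, LipschitzOnWith C (g ∘ f) t := by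
  obtain ⟨C, t, ht, hC⟩ := hf
  obtain ⟨D, u, hu, hD⟩ := hg.exists_lipschitzOnWith
  have hc : ContinuousWithinAt f s x :=
    (hC.continuousOn x (mem_of_mem_nhdsWithin hx ht)).mono_of_mem_nhdsWithin ht
  exact ⟨D * C, t ∩ f ⁻¹' u, inter_mem ht (hc hu),
    hD.comp (hC.mono inter_subset_left) fun y hy ↦ hy.2⟩

theorem LocallyLipschitzOn.contDiffAt_comp {A E F : Type*} [PseudoEMetricSpace A]
    [NormedAddCommGroup E] [NormedSpace ℝ E] [NormedAddCommGroup F] [NormedSpace ℝ F]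
    {f : A → E} {s : Set A} (hf : LocallyLipschitzOn s f) {g : E → F}
    (hg : ∀ x ∈ s, ContDiffAt ℝ 1 g (f x)) : LocallyLipschitzOn s (g ∘ f) :=
  fun x hx ↦ exists_lipschitzOnWith_comp_contDiffAt hx (hf hx) (hg x hx)

theorem LocallyLipschitzOn.prodMk {A E F : Type*} [PseudoEMetricSpace A]
    [PseudoEMetricSpace E] [PseudoEMetricSpace F] {s : Set A} {f : A → E} {g : A → F}
    (hf : LocallyLipschitzOn s f) (hg : LocallyLipschitzOn s g) :
    LocallyLipschitzOn s fun x ↦ (f x, g x) := by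
  intro x hx
  obtain ⟨C, t, ht, hC⟩ := hf hx
  obtain ⟨D, u, hu, hD⟩ := hg hx
  exact ⟨max C D, t ∩ u, inter_mem ht hu,
    (hC.mono inter_subset_left).prodMk (hD.mono inter_subset_right)⟩

/-- On a compact interval, locally Lipschitz implies Lipschitz, hence absolutely continuous, so the
fundamental theorem of calculus holds with an almost everywhere derivative. This is the form of
monotonicity needed for curves that solve their equation only almost everywhere. -/
theorem LocallyLipschitzOn.le_of_ae_deriv_nonpos {f : ℝ → ℝ} {a b : ℝ} (hab : a ≤ b)
    (hf : LocallyLipschitzOn (Icc a b) f)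
    (hd : ∀ᵐ t ∂volume.restrict (Icc a b), ∃ d ≤ 0, HasDerivAt f d t) : f b ≤ f a := by
  obtain ⟨C, hC⟩ := hf.exists_lipschitzOnWith_of_compact isCompact_Icc
  have hac : AbsolutelyContinuousOnInterval f a b :=
    LipschitzOnWith.absolutelyContinuousOnInterval (K := C) (by rwa [uIcc_of_le hab])
  have h := hac.integral_deriv_eq_sub
  rw [intervalIntegral.integral_of_le hab] at h
  have : ∫ x in Ioc a b, deriv f x ≤ 0 := by
    refine integral_nonpos_of_ae ?_
    have hd' := ae_restrict_of_ae_restrict_of_subset Ioc_subset_Icc_self hd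
    filter_upwards [hd'] with t ht
    obtain ⟨d, hd0, hd⟩ := ht
    simpa [hd.deriv] using hd0
  linarith

end Lipschitz

/-! ## Second order Taylor estimate and local flows -/

section Calculus

variable {E F : Type*} [NormedAddCommGroup E] [NormedSpace ℝ E]
  [NormedAddCommGroup F] [NormedSpace ℝ F]

/-- The derivative is locally Lipschitz, and the mean value inequality on segments of a ball does
the rest. The point is uniformity: one constant serves all base points near `x₀`, hence all points
of a characteristic. -/
theorem ContDiffAt.exists_taylor_two {f : E → F} {x₀ : E} (hf : ContDiffAt ℝ 2 f x₀) :
    ∃ C : ℝ, 0 ≤ C ∧ ∃ r > 0, ∀ x ∈ Metric.ball x₀ r, ∀ y ∈ Metric.ball x₀ r,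
      ‖f y - f x - fderiv ℝ f x (y - x)‖ ≤ C * ‖y - x‖ ^ 2 := by
  have h1 : ContDiffAt ℝ 1 (fderiv ℝ f) x₀ := hf.fderiv_right (by norm_num)
  obtain ⟨C, t, ht, hC⟩ := h1.exists_lipschitzOnWith
  have hd : ∀ᶠ x in 𝓝 x₀, DifferentiableAt ℝ f x :=
    (hf.eventually (by simp)).mono fun x hx ↦ hx.differentiableAt (by simp)
  obtain ⟨r, hr, hball⟩ := Metric.mem_nhds_iff.1 (inter_mem ht hd)
  refine ⟨C, C.2, r, hr, fun x hx y hy ↦ ?_⟩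
  have hseg : segment ℝ x y ⊆ Metric.ball x₀ r := (convex_ball x₀ r).segment_subset hx hy
  have := (convex_segment x y).norm_image_sub_le_of_norm_fderiv_le' (𝕜 := ℝ) (f := f)
    (φ := fderiv ℝ f x) (C := C * ‖y - x‖) (fun z hz ↦ (hball (hseg hz)).2) (fun z hz ↦ ?_)
    (left_mem_segment ℝ x y) (right_mem_segment ℝ x y)
  · calc _ ≤ _ := this
      _ = _ := by ring
  · refine (hC.norm_sub_le (hball (hseg hz)).1 (hball hx).1).trans ?_
    gcongr
    obtain ⟨s, ⟨hs0, hs1⟩, rfl⟩ := (segment_eq_image' ℝ x y ▸ hz)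
    simp only [add_sub_cancel_left, norm_smul, Real.norm_eq_abs, abs_of_nonneg hs0]
    exact mul_le_of_le_one_left (norm_nonneg _) hs1

/-- A vector field of class `C¹` has a local flow, continuous in the initial point, that stays in
any prescribed neighbourhood for a short time. -/
theorem ContDiffAt.exists_local_flow [CompleteSpace E] {v : E → E} {z₀ : E}
    (hv : ContDiffAt ℝ 1 v z₀) {O : Set E} (hO : O ∈ 𝓝 z₀) :
    ∃ U ∈ 𝓝 z₀, ∃ δ > 0, ∃ α : E → ℝ → E,
      (∀ z ∈ U, α z 0 = z ∧ ∀ t ∈ Icc (0 : ℝ) δ, HasDerivWithinAt (α z) (v (α z t)) (Icc 0 δ) t ∧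
        α z t ∈ O) ∧
      ∀ t ∈ Icc (0 : ℝ) δ, ContinuousOn (fun z ↦ α z t) U := by
  obtain ⟨ε, hε, a, r, L, K, hr, hpl⟩ := IsPicardLindelof.of_contDiffAt_one hv
  obtain ⟨α, hα, hc⟩ := (hpl 0).exists_forall_mem_closedBall_eq_hasDerivWithinAt_continuousOn
  have h0 : (0 : ℝ) ∈ Icc (0 - ε) (0 + ε) := by constructor <;> linarith
  have hz0 : z₀ ∈ Metric.closedBall z₀ (r : ℝ) := Metric.mem_closedBall_self r.2
  have hcat : ContinuousAt α (z₀, 0) := hc.continuousAt <| prod_mem_nhds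
    (Metric.closedBall_mem_nhds z₀ hr) (Icc_mem_nhds (by linarith) (by linarith))
  have hval : α (z₀, 0) = z₀ := (hα z₀ hz0).1
  -- Joint continuity at `(z₀, 0)` gives a product neighbourhood on which the flow stays in `O`, so
  -- one time `δ` serves all initial points in it.
  have hev : ∀ᶠ q in 𝓝 (z₀, (0 : ℝ)), α q ∈ O := hcat (by rwa [hval])
  rw [nhds_prod_eq, Filter.eventually_prod_iff] at hev
  obtain ⟨pa, hpa, pb, hpb, hab⟩ := hev
  obtain ⟨δ, hδ, hball⟩ := Metric.mem_nhds_iff.1 hpb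
  have hδ' : Icc (0 : ℝ) (min ε (δ / 2)) ⊆ Icc (0 - ε) (0 + ε) := fun t ht ↦
    ⟨by linarith [ht.1], by linarith [ht.2, min_le_left ε (δ / 2)]⟩
  refine ⟨Metric.closedBall z₀ r ∩ {z | pa z},
    inter_mem (Metric.closedBall_mem_nhds z₀ hr) hpa, min ε (δ / 2), by positivity,
    fun z t ↦ α (z, t), fun z hz ↦ ⟨(hα z hz.1).1, fun t ht ↦
      ⟨((hα z hz.1).2 t (hδ' ht)).mono hδ', hab hz.2 (hball ?_)⟩⟩, fun t ht ↦ ?_⟩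
  · rw [Metric.mem_ball, Real.dist_eq, sub_zero, abs_of_nonneg ht.1]
    linarith [ht.2, min_le_right ε (δ / 2)]
  · exact hc.comp (by fun_prop) fun z hz ↦ ⟨hz.1, hδ' ht⟩

end Calculus

/-! ## Hamiltonian vector fields on `E × E*` -/

section Symplectic

variable {E : Type*} [NormedAddCommGroup E] [NormedSpace ℝ E] [FiniteDimensional ℝ E]

variable (E) in
/-- The coordinates of a basis of `E`, as continuous linear forms. -/
def basisCoord (i : Fin (Module.finrank ℝ E)) : E →L[ℝ] ℝ :=
  LinearMap.toContinuousLinearMap ((Module.finBasis ℝ E).coord i)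

theorem sum_apply_basis_smul_basisCoord (l : E →L[ℝ] ℝ) :
    ∑ i, l (Module.finBasis ℝ E i) • basisCoord E i = l := by
  ext v
  conv_rhs => rw [← (Module.finBasis ℝ E).sum_repr v, map_sum]
  rw [sum_apply]
  refine Finset.sum_congr rfl fun i _ ↦ ?_
  rw [map_smul, smul_eq_mul, mul_comm]
  rfl

/-- The Hamiltonian vector field of a function on `E × E*`. -/
def hamiltonianField (h : E × (E →L[ℝ] ℝ) → ℝ) (z : E × (E →L[ℝ] ℝ)) : E × (E →L[ℝ] ℝ) :=
  (∑ i, fderiv ℝ h z (0, basisCoord E i) • Module.finBasis ℝ E i,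
    -(fderiv ℝ h z).comp (ContinuousLinearMap.inl ℝ E (E →L[ℝ] ℝ)))

/-- The basis sum in `hamiltonianField` is the identification of `E**` with `E`: it represents the
momentum derivative of `h` by a vector of `E`. -/
theorem fderiv_eq_hamiltonianField (h : E × (E →L[ℝ] ℝ) → ℝ) (z w : E × (E →L[ℝ] ℝ)) :
    fderiv ℝ h z w = w.2 (hamiltonianField h z).1 - (hamiltonianField h z).2 w.1 := by
  have h1 : w.2 (hamiltonianField h z).1 = fderiv ℝ h z (0, w.2) := by
    have : ((0 : E), w.2) = ∑ i, w.2 (Module.finBasis ℝ E i) • ((0 : E), basisCoord E i) := by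
      ext1
      · simp [Prod.fst_sum]
      · rw [Prod.snd_sum]
        exact (sum_apply_basis_smul_basisCoord w.2).symm
    rw [this, map_sum, hamiltonianField, map_sum]
    refine Finset.sum_congr rfl fun i _ ↦ ?_
    rw [map_smul, map_smul, smul_eq_mul, smul_eq_mul, mul_comm]
  have h2 : (hamiltonianField h z).2 w.1 = -fderiv ℝ h z (w.1, 0) := rfl
  rw [h1, h2, sub_neg_eq_add, ← map_add]
  simp

/-- Nondegeneracy of the symplectic form, tested on the vectors `(0, l)` and `(x, 0)`. -/
theorem eq_hamiltonianField_iff {h : E × (E →L[ℝ] ℝ) → ℝ} {z v : E × (E →L[ℝ] ℝ)} :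
    v = hamiltonianField h z ↔ ∀ w : E × (E →L[ℝ] ℝ), fderiv ℝ h z w = w.2 v.1 - v.2 w.1 := by
  refine ⟨fun hv w ↦ hv ▸ fderiv_eq_hamiltonianField h z w, fun hv ↦ Prod.ext ?_ ?_⟩
  · refine sub_eq_zero.1 (SeparatingDual.eq_zero_of_forall_dual_eq_zero (R := ℝ) fun l ↦ ?_)
    have := (hv (0, l)).symm.trans (fderiv_eq_hamiltonianField h z (0, l))
    simp only [map_zero, sub_zero] at this
    rw [map_sub, this, sub_self]
  · refine ContinuousLinearMap.ext fun x ↦ ?_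
    have := (hv (x, 0)).symm.trans (fderiv_eq_hamiltonianField h z (x, 0))
    change 0 - v.2 x = 0 - (hamiltonianField h z).2 x at this
    linarith

theorem ContDiffAt.hamiltonianField {h : E × (E →L[ℝ] ℝ) → ℝ} {z : E × (E →L[ℝ] ℝ)}
    (hh : ContDiffAt ℝ 2 h z) : ContDiffAt ℝ 1 (hamiltonianField h) z := by
  have h1 : ContDiffAt ℝ 1 (fderiv ℝ h) z := hh.fderiv_right (by norm_num)
  refine ContDiffAt.prodMk (ContDiffAt.sum fun i _ ↦ ?_) (ContDiffAt.neg ?_)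
  · exact (h1.clm_apply contDiffAt_const).smul contDiffAt_const
  · exact h1.clm_comp contDiffAt_const

end Symplectic

/-! ## Sublinear Hamiltonians and the quadratic verification function -/

section Verification

variable {E : Type*} [NormedAddCommGroup E] [NormedSpace ℝ E]

/-- Euler's identity. It makes the action `p q' - h` vanish along characteristics, which is why
values are transported unchanged. -/
theorem fderiv_of_homogeneous {h : E × (E →L[ℝ] ℝ) → ℝ} {q : E}
    (hhom : ∀ (l : E →L[ℝ] ℝ) (c : ℝ), 0 < c → h (q, c • l) = c * h (q, l)) {p : E →L[ℝ] ℝ}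
    (hd : DifferentiableAt ℝ h (q, p)) : fderiv ℝ h (q, p) (0, p) = h (q, p) := by
  have h1 : HasDerivAt (fun s : ℝ ↦ h (q, s • p)) (fderiv ℝ h (q, p) (0, p)) 1 := by
    have hin : HasDerivAt (fun s : ℝ ↦ (q, s • p)) ((0 : E), (1 : ℝ) • p) 1 :=
      (hasDerivAt_const _ _).prodMk ((hasDerivAt_id (1 : ℝ)).smul_const p)
    have := HasFDerivAt.comp_hasDerivAt (x := (1 : ℝ)) (l := h) (f := fun s : ℝ ↦ (q, s • p))
      (by simpa using hd.hasFDerivAt) hin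
    simpa [Function.comp_def] using this
  have h2 : HasDerivAt (fun s : ℝ ↦ h (q, s • p)) (h (q, p)) 1 := by
    have : HasDerivAt (fun s : ℝ ↦ s * h (q, p)) (1 * h (q, p)) 1 :=
      (hasDerivAt_id (1 : ℝ)).mul_const _
    rw [one_mul] at this
    refine this.congr_of_eventuallyEq ?_
    filter_upwards [lt_mem_nhds (zero_lt_one' ℝ)] with s hs using hhom p s hs
  exact h1.unique h2

/-- By sublinearity each difference quotient of `h` in the direction `l` is at most `h (q, l)`. So
the velocity of a characteristic is itself dominated by `h`. -/
theorem fderiv_le_of_sublinear {h : E × (E →L[ℝ] ℝ) → ℝ} {q : E}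
    (hhom : ∀ (l : E →L[ℝ] ℝ) (c : ℝ), 0 < c → h (q, c • l) = c * h (q, l))
    (hsub : ∀ l m : E →L[ℝ] ℝ, h (q, l + m) ≤ h (q, l) + h (q, m)) {p : E →L[ℝ] ℝ}
    (hd : DifferentiableAt ℝ h (q, p)) (l : E →L[ℝ] ℝ) :
    fderiv ℝ h (q, p) (0, l) ≤ h (q, l) := by
  have h1 : HasDerivAt (fun s : ℝ ↦ h (q, p + s • l)) (fderiv ℝ h (q, p) (0, l)) 0 := by
    have hin : HasDerivAt (fun s : ℝ ↦ (q, p + s • l)) ((0 : E), (1 : ℝ) • l) 0 :=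
      (hasDerivAt_const _ _).prodMk (((hasDerivAt_id (0 : ℝ)).smul_const l).const_add p)
    have := HasFDerivAt.comp_hasDerivAt (x := (0 : ℝ)) (l := h) (f := fun s : ℝ ↦ (q, p + s • l))
      (by simpa using hd.hasFDerivAt) hin
    simpa [Function.comp_def] using this
  have h2 := (hasDerivAt_iff_tendsto_slope.1 h1).mono_left (nhdsGT_le_nhdsNE (0 : ℝ))
  refine le_of_tendsto h2 ?_
  filter_upwards [self_mem_nhdsWithin] with s (hs : 0 < s)
  rw [slope_def_field, sub_zero, div_le_iff₀ hs]
  have := hsub p (s • l)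
  rw [hhom l s hs] at this
  simp only [zero_smul, add_zero]
  linarith

variable [FiniteDimensional ℝ E]

set_option maxHeartbeats 1000000 in
/-- Local optimality of the characteristics of a Hamiltonian that is sublinear in the momentum,
among the curves whose velocities are dominated by the Hamiltonian. -/
theorem exists_verification_function {h : E × (E →L[ℝ] ℝ) → ℝ} {a : E → ℝ} {q₀ : E}
    (ha : ContDiffAt ℝ 2 a q₀) (hh : ContDiffAt ℝ 2 h (q₀, fderiv ℝ a q₀))
    (hhom : ∀ᶠ q in 𝓝 q₀, ∀ (l : E →L[ℝ] ℝ) (c : ℝ), 0 < c → h (q, c • l) = c * h (q, l)) :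
    ∃ U ∈ 𝓝 q₀, ∃ O ∈ 𝓝 (q₀, fderiv ℝ a q₀), ∃ δ > 0, ∀ ε ∈ Ioo 0 δ,
      ∀ γ : ℝ → E × (E →L[ℝ] ℝ),
      (∀ t ∈ Icc 0 ε, γ t ∈ O ∧ HasDerivWithinAt γ (hamiltonianField h (γ t)) (Icc 0 ε) t) →
      (γ 0).2 = fderiv ℝ a (γ 0).1 →
      ∃ φ : E → ℝ, φ (γ ε).1 = a (γ 0).1 ∧ HasFDerivAt φ (γ ε).2 (γ ε).1 ∧
        ∀ ζ : ℝ → E, LocallyLipschitzOn (Icc 0 1) ζ → (∀ t ∈ Icc (0 : ℝ) 1, ζ t ∈ U) →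
          (∀ᵐ t ∂volume.restrict (Icc (0 : ℝ) 1), ∃ v, HasDerivAt ζ v t ∧
            ∀ l : E →L[ℝ] ℝ, l v ≤ ε * h (ζ t, l)) →
          φ (ζ 1) ≤ a (ζ 0) ∧ (φ (ζ 1) = a (ζ 0) → ζ 0 = (γ 0).1) := by
  obtain ⟨Ca, hCa, ra, hra, hTa⟩ := ha.exists_taylor_two
  obtain ⟨Ch, hCh, rh, hrh, hTh⟩ := hh.exists_taylor_two
  have hgood : ∀ᶠ z in 𝓝 (q₀, fderiv ℝ a q₀), ContDiffAt ℝ 2 h z ∧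
      ∀ (l : E →L[ℝ] ℝ) (c : ℝ), 0 < c → h (z.1, c • l) = c * h (z.1, l) :=
    (hh.eventually (by simp)).and ((continuous_fst.tendsto (q₀, fderiv ℝ a q₀)).eventually hhom)
  obtain ⟨rg, hrg, hballg⟩ := Metric.mem_nhds_iff.1 hgood
  -- The given norm of `E` need not come from an inner product, so the paraboloid uses the square of
  -- a Euclidean norm carried over by `T`.
  set T : E ≃L[ℝ] EuclideanSpace ℝ (Fin (Module.finrank ℝ E)) := toEuclidean
  set cT : ℝ := ‖(T.symm : EuclideanSpace ℝ (Fin (Module.finrank ℝ E)) →L[ℝ] E)‖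
  have hcT0 : 0 ≤ cT := norm_nonneg _
  have hcT : ∀ w, ‖w‖ ≤ cT * ‖T w‖ := fun w ↦ by
    simpa using (T.symm : EuclideanSpace ℝ (Fin (Module.finrank ℝ E)) →L[ℝ] E).le_opNorm (T w)
  set nT : ℝ := ‖(T : E →L[ℝ] EuclideanSpace ℝ (Fin (Module.finrank ℝ E)))‖
  have hnT0 : 0 ≤ nT := norm_nonneg _
  have hnT : ∀ w, ‖T w‖ ≤ nT * ‖w‖ := fun w ↦
    (T : E →L[ℝ] EuclideanSpace ℝ (Fin (Module.finrank ℝ E))).le_opNorm w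
  -- `C` is the initial opening: `Ca * cT ^ 2` absorbs the Taylor remainder of `a`, and the extra
  -- `1` leaves the gap that identifies the starting point. `B` will bound `(w, η κ w)` for openings
  -- up to `C + 1`, and the growth rate `Mc` of the opening absorbs the Taylor remainder of `h`.
  set C : ℝ := Ca * cT ^ 2 + 1
  have hC0 : 0 ≤ C := by positivity
  set B : ℝ := cT + 2 * (C + 1) * nT
  have hB0 : 0 ≤ B := by positivity
  set Mc : ℝ := Ch * B ^ 2
  have hMc0 : 0 ≤ Mc := by positivity
  -- the perturbation of the momentum
  let η : ℝ → E → (E →L[ℝ] ℝ) := fun κ w ↦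
    (-(2 * κ)) • (innerSL ℝ (T w)).comp (T : E →L[ℝ] EuclideanSpace ℝ (Fin (Module.finrank ℝ E)))
  have hηapp : ∀ κ w v, η κ w v = -(2 * κ) * inner ℝ (T w) (T v) := fun κ w v ↦ by
    simp [η]
  have hη : ∀ κ w, 0 ≤ κ → κ ≤ C + 1 → ‖(w, η κ w)‖ ≤ B * ‖T w‖ := by
    intro κ w h0 h1
    have e1 : ‖η κ w‖ ≤ 2 * (C + 1) * nT * ‖T w‖ := by
      simp only [η]
      rw [norm_smul, norm_neg, Real.norm_eq_abs, abs_of_nonneg (by positivity)]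
      calc 2 * κ * ‖(innerSL ℝ (T w)).comp (T : E →L[ℝ] EuclideanSpace ℝ (Fin (Module.finrank ℝ E)))‖
          ≤ 2 * (C + 1) * (‖T w‖ * nT) := by
            gcongr
            refine (ContinuousLinearMap.opNorm_comp_le _ _).trans ?_
            rw [innerSL_apply_norm]
        _ = _ := by ring
    have e2 := hcT w
    have e3 : 0 ≤ cT * ‖T w‖ := by positivity
    have e4 : 0 ≤ 2 * (C + 1) * nT * ‖T w‖ := by positivity
    rw [Prod.norm_def]
    refine max_le ?_ ?_ <;> simp only [B] <;> nlinarith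
  set R : ℝ := min rh rg
  have hR : 0 < R := lt_min hrh hrg
  -- Two points of the `r`-ball differ by at most `2r`, so `(w, η κ w)` has norm at most `R / 2`;
  -- added to a point of the characteristic, it stays where the Taylor estimate of `h` is valid.
  set r : ℝ := min (min (R / 2) ra) (R / (4 * (B * nT + 1)))
  have hr : 0 < r := by positivity
  have hrR : r ≤ R / 2 := (min_le_left _ _).trans (min_le_left _ _)
  have hrra : r ≤ ra := (min_le_left _ _).trans (min_le_right _ _)
  have hrB : B * nT * (2 * r) ≤ R / 2 := by
    have h1 : r * (4 * (B * nT + 1)) ≤ R := by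
      rw [← le_div_iff₀ (by positivity)]; exact min_le_right _ _
    nlinarith
  -- Times below `1 / (Mc + 1)` keep the opening `C + Mc * s` at most `C + 1`, as the choice of `B`
  -- requires.
  refine ⟨Metric.ball q₀ r, Metric.ball_mem_nhds _ hr, Metric.ball (q₀, fderiv ℝ a q₀) r,
    Metric.ball_mem_nhds _ hr, 1 / (Mc + 1), by positivity, fun ε hε γ hγ hγ0 ↦ ?_⟩
  have hMε : Mc * ε ≤ 1 := by
    have := hε.2
    rw [lt_div_iff₀ (by positivity)] at this
    nlinarith [hε.1]
  have hfst : ∀ z ∈ Metric.ball (q₀, fderiv ℝ a q₀) r, z.1 ∈ Metric.ball q₀ r := fun z hz ↦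
    (ball_prod_same q₀ (fderiv ℝ a q₀) r ▸ hz : z ∈ Metric.ball q₀ r ×ˢ _).1
  -- The moving paraboloid: at time `s` it has value `a (γ 0).1` and differential `(γ s).2` at the
  -- point `(γ s).1`.
  let Φ : ℝ → E → ℝ := fun s y ↦
    a (γ 0).1 + (γ s).2 (y - (γ s).1) - (C + Mc * s) * ‖T (y - (γ s).1)‖ ^ 2
  refine ⟨Φ ε, by simp [Φ], ?_, fun ζ hζ hζU hζd ↦ ?_⟩
  · have h1 : HasFDerivAt (fun y ↦ T (y - (γ ε).1))
        (T : E →L[ℝ] EuclideanSpace ℝ (Fin (Module.finrank ℝ E))) (γ ε).1 :=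
      (T : E →L[ℝ] EuclideanSpace ℝ (Fin (Module.finrank ℝ E))).hasFDerivAt.comp _ ((hasFDerivAt_id _).sub_const _)
    have h2 : HasFDerivAt (fun y ↦ (γ ε).2 (y - (γ ε).1)) (γ ε).2 (γ ε).1 :=
      (γ ε).2.hasFDerivAt.comp _ ((hasFDerivAt_id _).sub_const _)
    have := (h2.const_add (a (γ 0).1)).sub ((h1.norm_sq).const_mul (C + Mc * ε))
    rw [sub_self, map_zero, map_zero, ContinuousLinearMap.zero_comp, smul_zero, smul_zero,
      sub_zero] at this
    exact this
  have h0 : (0 : ℝ) ∈ Icc 0 ε := ⟨le_rfl, hε.1.le⟩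
  have hscale : ∀ t ∈ Icc (0 : ℝ) 1, ε * t ∈ Icc 0 ε := fun t ht ↦
    ⟨mul_nonneg hε.1.le ht.1, mul_le_of_le_one_right hε.1.le ht.2⟩
  -- initial comparison
  have hinit : Φ 0 (ζ 0) + ‖T (ζ 0 - (γ 0).1)‖ ^ 2 ≤ a (ζ 0) := by
    have hx := hfst _ (hγ 0 h0).1
    have := hTa (γ 0).1 (Metric.ball_subset_ball hrra hx) (ζ 0)
      (Metric.ball_subset_ball hrra (hζU 0 ⟨le_rfl, zero_le_one⟩))
    rw [Real.norm_eq_abs, abs_le] at this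
    have h2 : Ca * ‖ζ 0 - (γ 0).1‖ ^ 2 ≤ Ca * cT ^ 2 * ‖T (ζ 0 - (γ 0).1)‖ ^ 2 := by
      rw [mul_assoc, ← mul_pow]
      gcongr
      exact hcT _
    simp only [Φ, hγ0, C]
    nlinarith [this.1]
  -- monotonicity along the curve
  have hmono : Φ (ε * 1) (ζ 1) ≤ Φ (ε * 0) (ζ 0) := by
    refine LocallyLipschitzOn.le_of_ae_deriv_nonpos (f := fun t ↦ Φ (ε * t) (ζ t)) zero_le_one
      ?_ ?_
    · have hγcont : ContinuousOn γ (Icc 0 ε) := fun t ht ↦ (hγ t ht).2.continuousWithinAt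
      have hvcont : ContinuousOn (fun t ↦ hamiltonianField h (γ t)) (Icc 0 ε) := fun t ht ↦ by
        have hz : γ t ∈ Metric.ball (q₀, fderiv ℝ a q₀) rg := Metric.ball_subset_ball
          (hrR.trans ((half_le_self hR.le).trans (min_le_right _ _))) (hγ t ht).1
        exact ((hballg hz).1.hamiltonianField.continuousAt).comp_continuousWithinAt (hγcont t ht)
      obtain ⟨b, hb⟩ := (isCompact_Icc.image_of_continuousOn hvcont).isBounded.exists_norm_le
      have hγlip : LipschitzOnWith (Real.toNNReal b) γ (Icc 0 ε) :=
        (convex_Icc 0 ε).lipschitzOnWith_of_nnnorm_hasDerivWithin_le (fun t ht ↦ (hγ t ht).2)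
          fun t ht ↦ by
            rw [← NNReal.coe_le_coe, coe_nnnorm]
            exact (hb _ ⟨t, ht, rfl⟩).trans (Real.le_coe_toNNReal b)
      have hγs : LocallyLipschitzOn (Icc 0 1) fun t ↦ γ (ε * t) := fun t ht ↦
        ⟨_, _, self_mem_nhdsWithin, hγlip.comp
          ((LipschitzWith.of_dist_le_mul (K := ⟨ε, hε.1.le⟩) fun x y ↦ by
            rw [Real.dist_eq, Real.dist_eq, ← mul_sub, abs_mul, abs_of_pos hε.1]
            rfl).lipschitzOnWith (s := Icc 0 1)) hscale⟩
      have hid : LocallyLipschitzOn (Icc (0 : ℝ) 1) fun t : ℝ ↦ t :=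
        (LipschitzWith.id.locallyLipschitz).locallyLipschitzOn
      let G : (ℝ × (E × (E →L[ℝ] ℝ))) × E → ℝ := fun z ↦
        a (γ 0).1 + z.1.2.2 (z.2 - z.1.2.1) -
          (C + Mc * (ε * z.1.1)) * ‖T (z.2 - z.1.2.1)‖ ^ 2
      have hG : ContDiff ℝ 1 G := by
        have h1 : ContDiff ℝ 1 fun z : (ℝ × (E × (E →L[ℝ] ℝ))) × E ↦ T (z.2 - z.1.2.1) :=
          T.contDiff.comp (by fun_prop)
        have h2 := h1.norm_sq ℝ
        simp only [G]
        fun_prop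
      exact ((hid.prodMk hγs).prodMk hζ).contDiffAt_comp fun t _ ↦ hG.contDiffAt
    · have hae : ∀ᵐ t ∂volume.restrict (Icc (0 : ℝ) 1), t ∈ Ioo (0 : ℝ) 1 := by
        rw [← restrict_Ioo_eq_restrict_Icc]
        exact ae_restrict_mem measurableSet_Ioo
      filter_upwards [hae, hζd] with t ht hv
      obtain ⟨v, hv, hdom⟩ := hv
      have htI : t ∈ Icc (0 : ℝ) 1 := Ioo_subset_Icc_self ht
      have hs : ε * t ∈ Icc 0 ε := hscale t htI
      set z := γ (ε * t) with hz
      set X := hamiltonianField h z with hX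
      have hzO := (hγ _ hs).1
      rw [← hz] at hzO
      have hzG := hballg (Metric.ball_subset_ball
          (hrR.trans ((half_le_self hR.le).trans (min_le_right _ _))) hzO)
      have hzh : z ∈ Metric.ball (q₀, fderiv ℝ a q₀) rh := Metric.ball_subset_ball
          (hrR.trans ((half_le_self hR.le).trans (min_le_left _ _))) hzO
      have hγd : HasDerivAt (fun t ↦ γ (ε * t)) (ε • X) t := by
        have h1 : HasDerivAt γ X (ε * t) := (hγ _ hs).2.hasDerivAt (Icc_mem_nhds
          (mul_pos hε.1 ht.1) (mul_lt_of_lt_one_right hε.1 ht.2))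
        have h2 : HasDerivAt (fun t : ℝ ↦ ε * t) ε t := by
          simpa using (hasDerivAt_id t).const_mul ε
        exact HasDerivAt.scomp t h1 h2
      set w := ζ t - z.1 with hw
      have hwd : HasDerivAt (fun t ↦ ζ t - (γ (ε * t)).1) (v - ε • X.1) t :=
        hv.sub ((ContinuousLinearMap.fst ℝ E (E →L[ℝ] ℝ)).hasFDerivAt.comp_hasDerivAt t hγd)
      have hpd : HasDerivAt (fun t ↦ (γ (ε * t)).2) (ε • X.2) t :=
        (ContinuousLinearMap.snd ℝ E (E →L[ℝ] ℝ)).hasFDerivAt.comp_hasDerivAt t hγd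
      have hTd : HasDerivAt (fun t ↦ T (ζ t - (γ (ε * t)).1)) (T (v - ε • X.1)) t :=
        (T : E →L[ℝ] EuclideanSpace ℝ (Fin (Module.finrank ℝ E))).hasFDerivAt.comp_hasDerivAt t hwd
      have hkd : HasDerivAt (fun t : ℝ ↦ C + Mc * (ε * t)) (Mc * ε) t := by
        simpa using (((hasDerivAt_id t).const_mul ε).const_mul Mc).const_add C
      have hfd := ((hpd.clm_apply hwd).const_add (a (γ 0).1)).sub (hkd.mul hTd.norm_sq)
      refine ⟨_, ?_, hfd⟩
      simp only [← hz, ← hw]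
      set κ := C + Mc * (ε * t) with hκ
      have hκ0 : 0 ≤ κ := by have := hs.1; positivity
      have hκ1 : κ ≤ C + 1 := by
        have : Mc * (ε * t) ≤ Mc * ε := mul_le_mul_of_nonneg_left hs.2 hMc0
        linarith
      have hWn := hη κ w hκ0 hκ1
      have hζr := hζU t htI
      have hwr : ‖w‖ ≤ 2 * r := by
        rw [hw, ← dist_eq_norm]
        have h1 := hfst z hzO
        rw [Metric.mem_ball] at h1 hζr
        linarith [dist_triangle_right (ζ t) z.1 q₀]
      have hW2 : ‖(w, η κ w)‖ ≤ R / 2 := by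
        refine hWn.trans (le_trans ?_ hrB)
        rw [mul_assoc]
        gcongr
        exact (hnT w).trans (by gcongr)
      have hzW : z + (w, η κ w) ∈ Metric.ball (q₀, fderiv ℝ a q₀) rh := by
        rw [Metric.mem_ball] at hzO ⊢
        have : dist (z + (w, η κ w)) z ≤ R / 2 := by simpa [dist_eq_norm] using hW2
        have h3 : R ≤ rh := min_le_left _ _
        linarith [dist_triangle (z + (w, η κ w)) z (q₀, fderiv ℝ a q₀)]
      have htay := hTh z hzh _ hzW
      rw [add_sub_cancel_left, Real.norm_eq_abs, abs_le] at htay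
      have hsq : Ch * ‖(w, η κ w)‖ ^ 2 ≤ Mc * ‖T w‖ ^ 2 := by
        simp only [Mc]
        rw [mul_assoc, ← mul_pow]
        gcongr
      have heuler : fderiv ℝ h z (0, z.2) = h z :=
        fderiv_of_homogeneous (q := z.1) (p := z.2) hzG.2 (hzG.1.differentiableAt (by simp))
      have hD := fderiv_eq_hamiltonianField h z (w, η κ w)
      rw [fderiv_eq_hamiltonianField] at heuler
      rw [← hX] at hD heuler
      simp only [map_zero, sub_zero] at heuler hD
      have hzadd : z + (w, η κ w) = (ζ t, z.2 + η κ w) := by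
        ext1 <;> simp [hw]
      -- The covector tested is the differential of the paraboloid at `ζ t`. Expanding `h` at `z`,
      -- the terms of order zero and one cancel by Euler's identity and Hamilton's equations; the
      -- quadratic remainder is at most `Mc * ‖T w‖ ^ 2`, exactly what the growing opening pays for.
      have hdom' := hdom (z.2 + η κ w)
      rw [← hzadd] at hdom'
      simp only [add_apply, hηapp] at hdom' hD
      rw [hD] at htay
      simp only [smul_apply, map_sub, map_smul, inner_sub_right,
        inner_smul_right, smul_eq_mul]
      have hkey : h (z + (w, η κ w)) ≤ h z + (-(2 * κ) * inner ℝ (T w) (T X.1) - X.2 w) +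
          Mc * ‖T w‖ ^ 2 := by linarith [htay.2]
      have := mul_le_mul_of_nonneg_left hkey hε.1.le
      rw [← heuler] at this
      linear_combination hdom'.trans this
  rw [mul_one, mul_zero] at hmono
  refine ⟨by nlinarith [sq_nonneg ‖T (ζ 0 - (γ 0).1)‖], fun heq ↦ ?_⟩
  have : ‖T (ζ 0 - (γ 0).1)‖ ^ 2 = 0 := le_antisymm (by linarith) (sq_nonneg _)
  have h1 : T (ζ 0 - (γ 0).1) = 0 := by simpa using this
  exact sub_eq_zero.1 (T.map_eq_zero_iff.1 h1)

end Verification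

/-! ## Canonical coordinates of the cotangent bundle -/

section CotangentChart

variable {E : Type*} [NormedAddCommGroup E] [NormedSpace ℝ E]
  {N : Type*} [TopologicalSpace N] [ChartedSpace E N] [IsManifold 𝓘(ℝ, E) ∞ N]

instance isManifold_cotangent : IsManifold (cotangentModel E) ∞ (Cotangent E N) := by
  have : IsManifold 𝓘(ℝ, E) ((∞ : WithTop ℕ∞) + 1) N := ‹IsManifold 𝓘(ℝ, E) ∞ N›
  have : ContMDiffVectorBundle ∞ E (fun x : N ↦ TangentSpace 𝓘(ℝ, E) x) 𝓘(ℝ, E) :=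
    TangentBundle.contMDiffVectorBundle
  infer_instance

variable (E) in
/-- The canonical coordinates of the cotangent bundle over the preferred chart at `x₀`. -/
def cotangentChart (x₀ : N) : OpenPartialHomeomorph (Cotangent E N) (E × (E →L[ℝ] ℝ)) :=
  chartAt (ModelProd E (E →L[ℝ] ℝ)) (⟨x₀, 0⟩ : Cotangent E N)

/-- The bundle chart at `p` depends only on the base point of `p`, so basing `cotangentChart` at the
zero covector loses nothing. -/
theorem extChartAt_cotangent (p : Cotangent E N) :
    extChartAt (cotangentModel E) p = (cotangentChart E p.proj).toPartialEquiv := by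
  simp only [mfld_simps]
  exact PartialEquiv.trans_refl _

theorem mem_cotangentChart_source {x₀ : N} {p : Cotangent E N} :
    p ∈ (cotangentChart E x₀).source ↔ p.proj ∈ (chartAt E x₀).source := by
  simp only [cotangentChart, FiberBundle.chartedSpace_chartAt]
  simp only [mfld_simps]
  exact ⟨fun h ↦ h.2, fun h ↦ ⟨⟨h, mem_univ _⟩, h⟩⟩

theorem mem_cotangentChart_target {x₀ : N} {z : E × (E →L[ℝ] ℝ)} :
    z ∈ (cotangentChart E x₀).target ↔ z.1 ∈ (chartAt E x₀).target := by
  rw [cotangentChart, FiberBundle.chartedSpace_chartAt]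
  simp only [mfld_simps]
  exact and_iff_left_of_imp fun h ↦ ⟨(chartAt E x₀).map_target h, mem_univ _⟩

/-- The covector of a point of the cotangent bundle, in the preferred chart of its base point. -/
def covector (p : Cotangent E N) : E →L[ℝ] ℝ := p.2

theorem cotangentChart_apply {x₀ : N} {p : Cotangent E N} (hp : p.proj ∈ (chartAt E x₀).source) :
    cotangentChart E x₀ p = (chartAt E x₀ p.proj,
      (covector p).comp (tangentCoordChange 𝓘(ℝ, E) x₀ p.proj p.proj)) := by
  rw [cotangentChart, hom_chart]
  refine Prod.ext rfl ?_
  simp only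
  rw [ContinuousLinearMap.inCoordinates, TangentBundle.symmL_trivializationAt_eq_core hp]
  ext v
  simp
  rfl

theorem cotangentChart_symm_proj {x₀ : N} {z : E × (E →L[ℝ] ℝ)}
    (hz : z.1 ∈ (chartAt E x₀).target) :
    ((cotangentChart E x₀).symm z).proj = (chartAt E x₀).symm z.1 := by
  have hz' := mem_cotangentChart_target.2 hz
  have h1 := (cotangentChart E x₀).map_target hz'
  rw [mem_cotangentChart_source] at h1
  have h2 := cotangentChart_apply h1
  rw [(cotangentChart E x₀).right_inv hz'] at h2
  have h3 : z.1 = chartAt E x₀ ((cotangentChart E x₀).symm z).proj := congrArg Prod.fst h2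
  rw [h3, (chartAt E x₀).left_inv h1]

theorem fderiv_chart_transition (x y n : N) :
    tangentCoordChange 𝓘(ℝ, E) x y n =
      fderiv ℝ (chartAt E y ∘ (chartAt E x).symm) (chartAt E x n) := by
  rw [tangentCoordChange_def]
  simp only [mfld_simps, fderivWithin_univ]

theorem contDiffAt_chart_transition {x y n : N} (hx : n ∈ (chartAt E x).source)
    (hy : n ∈ (chartAt E y).source) :
    ContDiffAt ℝ ∞ (chartAt E y ∘ (chartAt E x).symm) (chartAt E x n) := by
  have := contDiffWithinAt_ext_coord_change (I := 𝓘(ℝ, E)) (n := ∞) y x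
    (y := chartAt E x n) (by simp [hx, hy])
  simpa [mfld_simps, contDiffWithinAt_univ] using this

/-- The change of canonical coordinates. -/
theorem cotangentChart_transition {x y : N} {z : E × (E →L[ℝ] ℝ)}
    (hz : z.1 ∈ (chartAt E x).target) (hy : (chartAt E x).symm z.1 ∈ (chartAt E y).source) :
    cotangentChart E y ((cotangentChart E x).symm z) =
      ((chartAt E y ∘ (chartAt E x).symm) z.1,
        z.2.comp (fderiv ℝ (chartAt E x ∘ (chartAt E y).symm)
          ((chartAt E y ∘ (chartAt E x).symm) z.1))) := by
  have hz' := mem_cotangentChart_target.2 hz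
  have h1 := (cotangentChart E x).map_target hz'
  rw [mem_cotangentChart_source] at h1
  have h2 := cotangentChart_apply h1
  rw [(cotangentChart E x).right_inv hz'] at h2
  have hproj := cotangentChart_symm_proj hz
  set p := (cotangentChart E x).symm z with hp
  rw [← hproj] at hy
  rw [cotangentChart_apply hy]
  refine Prod.ext (by simp [hproj]) ?_
  simp only [Function.comp_apply, ← hproj]
  rw [← fderiv_chart_transition, h2]
  ext v
  simp only [ContinuousLinearMap.comp_apply]
  rw [tangentCoordChange_comp]
  simp only [extChartAt_source]
  exact ⟨⟨hy, h1⟩, mem_chart_source E p.proj⟩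

/-- The lift of a change of coordinates to covectors is symplectic. -/
theorem exists_hasFDerivAt_cotangent_lift {τ σ : E → E} {z : E × (E →L[ℝ] ℝ)}
    (hτ : DifferentiableAt ℝ τ z.1) (hσ : ContDiffAt ℝ 2 σ (τ z.1))
    (hinv : ∀ᶠ q in 𝓝 z.1, σ (τ q) = q) :
    ∃ A : (E × (E →L[ℝ] ℝ)) →L[ℝ] (E × (E →L[ℝ] ℝ)),
      HasFDerivAt (fun y : E × (E →L[ℝ] ℝ) ↦ (τ y.1, y.2.comp (fderiv ℝ σ (τ y.1)))) A z ∧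
      ∀ v w, (A w).2 (A v).1 - (A v).2 (A w).1 = w.2 v.1 - v.2 w.1 := by
  have hσ1 : DifferentiableAt ℝ (fderiv ℝ σ) (τ z.1) :=
    (hσ.fderiv_right (m := 1) (by norm_num)).differentiableAt (by simp)
  have h1 : HasFDerivAt (fun y : E × (E →L[ℝ] ℝ) ↦ τ y.1)
      ((fderiv ℝ τ z.1).comp (ContinuousLinearMap.fst ℝ E (E →L[ℝ] ℝ))) z :=
    hτ.hasFDerivAt.comp z hasFDerivAt_fst
  have h2 := hσ1.hasFDerivAt.comp z h1
  have h3 := (hasFDerivAt_snd (𝕜 := ℝ) (p := z)).clm_comp h2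
  have hid : (fderiv ℝ σ (τ z.1)).comp (fderiv ℝ τ z.1) = ContinuousLinearMap.id ℝ E := by
    have hc := (hσ.differentiableAt (by simp)).hasFDerivAt.comp z.1 hτ.hasFDerivAt
    exact hc.unique ((hasFDerivAt_id z.1).congr_of_eventuallyEq hinv)
  have hid' : ∀ v, fderiv ℝ σ (τ z.1) (fderiv ℝ τ z.1 v) = v := fun v ↦
    congrArg (fun L : E →L[ℝ] E ↦ L v) hid
  -- The second derivative of `σ` enters the lifted form only antisymmetrized, so its symmetry
  -- cancels it.
  have hsymm : IsSymmSndFDerivAt ℝ σ (τ z.1) := hσ.isSymmSndFDerivAt (by simp)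
  refine ⟨_, h1.prodMk h3, fun v w ↦ ?_⟩
  have := hsymm (fderiv ℝ τ z.1 v.1) (fderiv ℝ τ z.1 w.1)
  simp [hid', this]

/-- In the coordinates of `cotangentChart`, `canonicalForm` is the canonical symplectic form. -/
theorem exists_hasMFDerivAt_cotangentChart {x₀ : N} {p : Cotangent E N}
    (hp : p.proj ∈ (chartAt E x₀).source) :
    ∃ A : (E × (E →L[ℝ] ℝ)) →L[ℝ] (E × (E →L[ℝ] ℝ)),
      HasMFDerivAt (cotangentModel E) 𝓘(ℝ, E × (E →L[ℝ] ℝ)) (cotangentChart E x₀) p A ∧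
      (∀ V W, (A W).2 (A V).1 - (A V).2 (A W).1 = canonicalForm p V W) ∧
      ∃ A' : (E × (E →L[ℝ] ℝ)) →L[ℝ] (E × (E →L[ℝ] ℝ)),
        HasMFDerivAt 𝓘(ℝ, E × (E →L[ℝ] ℝ)) (cotangentModel E) (cotangentChart E x₀).symm
          (cotangentChart E x₀ p) A' ∧ ∀ w, A (A' w) = w := by
  have hps : p ∈ (cotangentChart E x₀).source := mem_cotangentChart_source.2 hp
  have hpp : p ∈ (cotangentChart E p.proj).source :=
    mem_cotangentChart_source.2 (mem_chart_source E p.proj)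
  set z := cotangentChart E p.proj p with hz
  have hz1 : z.1 = chartAt E p.proj p.proj := by
    rw [hz, cotangentChart_apply (mem_chart_source E p.proj)]
  have hn : (chartAt E p.proj).symm z.1 = p.proj := by
    rw [hz1, (chartAt E p.proj).left_inv (mem_chart_source E p.proj)]
  have hτn : (chartAt E x₀ ∘ (chartAt E p.proj).symm) z.1 = chartAt E x₀ p.proj := by simp [hn]
  -- `canonicalForm` is written in the chart at the base point of `p` itself, so passing to the
  -- chart at `x₀` requires the symplectic invariance of the lifted coordinate change.
  obtain ⟨A, hA, hform⟩ := exists_hasFDerivAt_cotangent_lift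
    (τ := chartAt E x₀ ∘ (chartAt E p.proj).symm) (σ := chartAt E p.proj ∘ (chartAt E x₀).symm)
    (z := z)
    (by
      rw [hz1]
      exact (contDiffAt_chart_transition (mem_chart_source E p.proj) hp).differentiableAt (by simp))
    (by
      rw [hτn]
      exact (contDiffAt_chart_transition hp (mem_chart_source E p.proj)).of_le
        (WithTop.coe_le_coe.2 le_top))
    (by
      have h1 : ∀ᶠ q in 𝓝 z.1, q ∈ (chartAt E p.proj).target :=
        (chartAt E p.proj).open_target.mem_nhds
          (hz1 ▸ (chartAt E p.proj).map_source (mem_chart_source E p.proj))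
      have h2 : ∀ᶠ q in 𝓝 z.1, (chartAt E p.proj).symm q ∈ (chartAt E x₀).source := by
        refine ((chartAt E p.proj).continuousAt_symm h1.self_of_nhds).eventually_mem ?_
        rw [hn]
        exact (chartAt E x₀).open_source.mem_nhds hp
      filter_upwards [h1, h2] with q hq1 hq2
      simp [hq1, hq2])
  have hMA : HasMFDerivAt (cotangentModel E) 𝓘(ℝ, E × (E →L[ℝ] ℝ)) (cotangentChart E x₀) p A := by
    refine ⟨(cotangentChart E x₀).continuousAt hps, ?_⟩
    have hw : writtenInExtChartAt (cotangentModel E) 𝓘(ℝ, E × (E →L[ℝ] ℝ)) p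
        (cotangentChart E x₀) = cotangentChart E x₀ ∘ (cotangentChart E p.proj).symm := by
      simp only [writtenInExtChartAt, mfld_simps]
      rfl
    rw [hw, extChartAt_cotangent]
    refine HasFDerivAt.hasFDerivWithinAt (hA.congr_of_eventuallyEq ?_)
    have h1 : ∀ᶠ y : E × (E →L[ℝ] ℝ) in 𝓝 z, y.1 ∈ (chartAt E p.proj).target :=
      continuous_fst.continuousAt.eventually_mem ((chartAt E p.proj).open_target.mem_nhds
          (hz1 ▸ (chartAt E p.proj).map_source (mem_chart_source E p.proj)))
    have h2 : ∀ᶠ y : E × (E →L[ℝ] ℝ) in 𝓝 z,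
        (chartAt E p.proj).symm y.1 ∈ (chartAt E x₀).source := by
      refine (((chartAt E p.proj).continuousAt_symm h1.self_of_nhds).comp
        continuous_fst.continuousAt).eventually_mem ?_
      rw [Function.comp_apply, hn]
      exact (chartAt E x₀).open_source.mem_nhds hp
    filter_upwards [h1, h2] with y hy1 hy2
    exact cotangentChart_transition hy1 hy2
  have hpt := (cotangentChart E x₀).map_source hps
  have hinv := (cotangentChart E x₀).left_inv hps
  have hMA' : MDifferentiableAt 𝓘(ℝ, E × (E →L[ℝ] ℝ)) (cotangentModel E)
      (cotangentChart E x₀).symm (cotangentChart E x₀ p) := by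
    have := contMDiffOn_extChartAt_symm (I := cotangentModel E) (n := 1) (⟨x₀, 0⟩ : Cotangent E N)
    rw [extChartAt_cotangent] at this
    exact (this.contMDiffAt ((cotangentChart E x₀).open_target.mem_nhds hpt)).mdifferentiableAt
      (by simp)
  obtain ⟨A', hA'⟩ : ∃ A' : (E × (E →L[ℝ] ℝ)) →L[ℝ] (E × (E →L[ℝ] ℝ)),
      HasMFDerivAt 𝓘(ℝ, E × (E →L[ℝ] ℝ)) (cotangentModel E) (cotangentChart E x₀).symm
        (cotangentChart E x₀ p) A' := ⟨_, hMA'.hasMFDerivAt⟩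
  refine ⟨A, hMA, fun V W ↦ hform V W, A', hA', fun w ↦ ?_⟩
  have hMA2 : HasMFDerivAt (cotangentModel E) 𝓘(ℝ, E × (E →L[ℝ] ℝ)) (cotangentChart E x₀)
      ((cotangentChart E x₀).symm (cotangentChart E x₀ p)) A := by
    rw [hinv]
    exact hMA
  have hcomp : HasFDerivAt (cotangentChart E x₀ ∘ (cotangentChart E x₀).symm) (A.comp A')
      (cotangentChart E x₀ p) := (HasMFDerivAt.comp _ hMA2 hA').hasFDerivAt
  have hid := hcomp.unique ((hasFDerivAt_id (cotangentChart E x₀ p)).congr_of_eventuallyEq ?_)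
  · exact congrArg (fun L : (E × (E →L[ℝ] ℝ)) →L[ℝ] (E × (E →L[ℝ] ℝ)) ↦ L w) hid
  · filter_upwards [(cotangentChart E x₀).open_target.mem_nhds hpt] with y hy
    exact (cotangentChart E x₀).right_inv hy

end CotangentChart

/-! ## Hamiltonian trajectories in canonical coordinates -/

section Trajectory

variable {E : Type*} [NormedAddCommGroup E] [NormedSpace ℝ E]
  {N : Type*} [TopologicalSpace N] [ChartedSpace E N] [IsManifold 𝓘(ℝ, E) ∞ N]

/-- Covectors over one base point lie in a common chart; others are separated by the projection.
Uniqueness of trajectories needs the diagonal to be closed. -/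
instance t2Space_cotangent [T2Space N] : T2Space (Cotangent E N) := by
  refine ⟨fun p q hpq ↦ ?_⟩
  by_cases h : p.proj = q.proj
  · have hp : p ∈ (cotangentChart E p.proj).source :=
      mem_cotangentChart_source.2 (mem_chart_source E p.proj)
    have hq : q ∈ (cotangentChart E p.proj).source :=
      mem_cotangentChart_source.2 (h ▸ mem_chart_source E p.proj)
    obtain ⟨u, v, hu, hv, hpu, hqv, huv⟩ :=
      t2_separation fun h ↦ hpq ((cotangentChart E p.proj).injOn hp hq h)
    exact ⟨_, _, (cotangentChart E p.proj).isOpen_inter_preimage hu,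
      (cotangentChart E p.proj).isOpen_inter_preimage hv, ⟨hp, hpu⟩, ⟨hq, hqv⟩,
      (huv.preimage _).mono inter_subset_right inter_subset_right⟩
  · exact separated_by_continuous (FiberBundle.continuous_proj _ _) h

theorem IsC2At.contDiffAt {H : Cotangent E N → ℝ} {x₀ : N} {p : Cotangent E N}
    (hp : p.proj ∈ (chartAt E x₀).source) (hH : IsC2At H p) :
    ContDiffAt ℝ 2 (H ∘ (cotangentChart E x₀).symm) (cotangentChart E x₀ p) := by
  have hps : p ∈ (cotangentChart E x₀).source := mem_cotangentChart_source.2 hp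
  have h1 := contMDiffOn_extChartAt_symm (I := cotangentModel E) (n := 2)
    (⟨x₀, 0⟩ : Cotangent E N)
  rw [extChartAt_cotangent] at h1
  have h2 := h1.contMDiffAt ((cotangentChart E x₀).open_target.mem_nhds
    ((cotangentChart E x₀).map_source hps))
  have h3 : ContMDiffAt (cotangentModel E) 𝓘(ℝ, ℝ) 2 H
      ((cotangentChart E x₀).symm (cotangentChart E x₀ p)) := by
    rw [(cotangentChart E x₀).left_inv hps]
    exact hH
  exact ContMDiffAt.contDiffAt (ContMDiffAt.comp _ h3 h2)

theorem hasMFDerivAt_of_isC2At {H : Cotangent E N → ℝ} {x₀ : N} {p : Cotangent E N}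
    (hp : p.proj ∈ (chartAt E x₀).source) (hH : IsC2At H p)
    {A : (E × (E →L[ℝ] ℝ)) →L[ℝ] (E × (E →L[ℝ] ℝ))}
    (hA : HasMFDerivAt (cotangentModel E) 𝓘(ℝ, E × (E →L[ℝ] ℝ)) (cotangentChart E x₀) p A) :
    HasMFDerivAt (cotangentModel E) 𝓘(ℝ, ℝ) H p
      ((fderiv ℝ (H ∘ (cotangentChart E x₀).symm) (cotangentChart E x₀ p)).comp A) := by
  have hps : p ∈ (cotangentChart E x₀).source := mem_cotangentChart_source.2 hp
  have h := HasMFDerivAt.comp p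
    ((hH.contDiffAt hp).differentiableAt (by simp)).hasFDerivAt.hasMFDerivAt hA
  refine h.congr_of_eventuallyEq ?_
  filter_upwards [(cotangentChart E x₀).open_source.mem_nhds hps] with q hq
  simp [(cotangentChart E x₀).left_inv hq]

variable [FiniteDimensional ℝ E]

/-- The chart derivative `A` preserves the symplectic form and, through its right inverse `A'`, is
onto. Testing against all `W` is therefore testing against all coordinate vectors. -/
theorem isHamiltonianVector_iff {H : Cotangent E N → ℝ} {x₀ : N} {p : Cotangent E N}
    (hp : p.proj ∈ (chartAt E x₀).source) (hH : IsC2At H p)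
    {A A' : (E × (E →L[ℝ] ℝ)) →L[ℝ] (E × (E →L[ℝ] ℝ))}
    (hA : HasMFDerivAt (cotangentModel E) 𝓘(ℝ, E × (E →L[ℝ] ℝ)) (cotangentChart E x₀) p A)
    (hform : ∀ V W, (A W).2 (A V).1 - (A V).2 (A W).1 = canonicalForm p V W)
    (hinv : ∀ w, A (A' w) = w) (V : TangentSpace (cotangentModel E) p) :
    IsHamiltonianVector H p V ↔
      A V = hamiltonianField (H ∘ (cotangentChart E x₀).symm) (cotangentChart E x₀ p) := by
  have hm := (hasMFDerivAt_of_isC2At hp hH hA).mfderiv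
  rw [eq_hamiltonianField_iff]
  constructor
  · intro h w
    have h1 : fderiv ℝ (H ∘ (cotangentChart E x₀).symm) (cotangentChart E x₀ p) (A (A' w)) =
        canonicalForm p V (A' w) := by
      rw [← h (A' w), hm]
      rfl
    have h2 := hform V (A' w)
    rw [hinv] at h1 h2
    exact h1.trans h2.symm
  · intro h W
    rw [hm]
    exact (h (A W)).trans (hform V W)

theorem IsHamiltonianTrajectory.hasDerivWithinAt {H : Cotangent E N → ℝ} {τ : ℝ}
    {γ : ℝ → Cotangent E N} (hγ : IsHamiltonianTrajectory H τ γ) {x₀ : N} {t : ℝ}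
    (ht : t ∈ Icc 0 τ) (hp : (γ t).proj ∈ (chartAt E x₀).source) :
    HasDerivWithinAt (cotangentChart E x₀ ∘ γ)
      (hamiltonianField (H ∘ (cotangentChart E x₀).symm) (cotangentChart E x₀ (γ t)))
      (Icc 0 τ) t := by
  obtain ⟨hC, V, hV, hd⟩ := hγ t ht
  obtain ⟨A, hA, hform, A', -, hinv⟩ := exists_hasMFDerivAt_cotangentChart hp
  rw [isHamiltonianVector_iff hp hC hA hform hinv] at hV
  have h : HasFDerivWithinAt (cotangentChart E x₀ ∘ γ)
      (A.comp ((1 : ℝ →L[ℝ] ℝ).smulRight (show E × (E →L[ℝ] ℝ) from V))) (Icc 0 τ) t :=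
    (HasMFDerivAt.comp_hasMFDerivWithinAt t hA hd).hasFDerivWithinAt
  rw [← hV]
  refine h.hasDerivWithinAt.congr_deriv ?_
  change A ((1 : ℝ) • (show E × (E →L[ℝ] ℝ) from V)) = A V
  rw [one_smul]

theorem isHamiltonianTrajectory_of_hasDerivWithinAt {H : Cotangent E N → ℝ} {τ : ℝ} {x₀ : N}
    {α : ℝ → E × (E →L[ℝ] ℝ)}
    (hα : ∀ t ∈ Icc 0 τ, α t ∈ (cotangentChart E x₀).target ∧
      IsC2At H ((cotangentChart E x₀).symm (α t)) ∧
      HasDerivWithinAt α (hamiltonianField (H ∘ (cotangentChart E x₀).symm) (α t)) (Icc 0 τ) t) :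
    IsHamiltonianTrajectory H τ ((cotangentChart E x₀).symm ∘ α) := by
  intro t ht
  obtain ⟨htar, hC, hd⟩ := hα t ht
  refine ⟨hC, ?_⟩
  have hp : ((cotangentChart E x₀).symm (α t)).proj ∈ (chartAt E x₀).source :=
    mem_cotangentChart_source.1 ((cotangentChart E x₀).map_target htar)
  obtain ⟨A, hA, hform, A', hA', hinv⟩ := exists_hasMFDerivAt_cotangentChart hp
  have hr := (cotangentChart E x₀).right_inv htar
  rw [hr] at hA'
  refine ⟨A' (hamiltonianField (H ∘ (cotangentChart E x₀).symm) (α t)), ?_, ?_⟩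
  · refine (isHamiltonianVector_iff hp hC hA hform hinv _).2 ?_
    rw [hinv, hr]
  · have := HasMFDerivAt.comp_hasMFDerivWithinAt t hA' hd.hasFDerivWithinAt.hasMFDerivWithinAt
    refine this.congr_mfderiv (ContinuousLinearMap.ext fun (r : ℝ) ↦ ?_)
    change A' (r • hamiltonianField (H ∘ (cotangentChart E x₀).symm) (α t)) = r • A' _
    rw [map_smul]

omit [FiniteDimensional ℝ E] in
theorem IsHamiltonianTrajectory.continuousOn {H : Cotangent E N → ℝ} {τ : ℝ}
    {γ : ℝ → Cotangent E N} (hγ : IsHamiltonianTrajectory H τ γ) : ContinuousOn γ (Icc 0 τ) :=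
  fun t ht ↦ (hγ t ht).2.choose_spec.2.continuousWithinAt

/-- Hamiltonian trajectories are determined by their initial point. -/
theorem IsHamiltonianTrajectory.eqOn [T2Space N] {H : Cotangent E N → ℝ} {τ : ℝ}
    {γ₁ γ₂ : ℝ → Cotangent E N} (h₁ : IsHamiltonianTrajectory H τ γ₁)
    (h₂ : IsHamiltonianTrajectory H τ γ₂) (h0 : γ₁ 0 = γ₂ 0) : EqOn γ₁ γ₂ (Icc 0 τ) := by
  have hclosed : IsClosed ({t | γ₁ t = γ₂ t} ∩ Icc 0 τ) := by
    have hc : ContinuousOn (fun t ↦ (γ₁ t, γ₂ t)) (Icc 0 τ) :=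
      h₁.continuousOn.prodMk h₂.continuousOn
    have := hc.preimage_isClosed_of_isClosed isClosed_Icc isClosed_diagonal
    rwa [inter_comm] at this
  -- Continuation: the coincidence set is closed, and from each of its points agreement propagates
  -- to the right, by uniqueness for a locally Lipschitz field in one chart.
  refine hclosed.Icc_subset_of_forall_exists_gt h0 fun t ht y hy ↦ ?_
  obtain ⟨heq, ht⟩ := ht
  have htI : t ∈ Icc 0 τ := Ico_subset_Icc_self ht
  set x₀ := (γ₁ t).proj with hx₀
  have hp : (γ₁ t).proj ∈ (chartAt E x₀).source := mem_chart_source E x₀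
  have hv := ((h₁ t htI).1.contDiffAt hp).hamiltonianField
  obtain ⟨C, u, hu, hC⟩ := hv.exists_lipschitzOnWith
  have hW : (cotangentChart E x₀).source ∩ cotangentChart E x₀ ⁻¹' u ∈ 𝓝 (γ₁ t) :=
    inter_mem ((cotangentChart E x₀).open_source.mem_nhds (mem_cotangentChart_source.2 hp))
      ((cotangentChart E x₀).continuousAt (mem_cotangentChart_source.2 hp) hu)
  have hev : ∀ᶠ s in 𝓝[Icc 0 τ] t,
      γ₁ s ∈ (cotangentChart E x₀).source ∩ cotangentChart E x₀ ⁻¹' u ∧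
      γ₂ s ∈ (cotangentChart E x₀).source ∩ cotangentChart E x₀ ⁻¹' u :=
    ((h₁.continuousOn t htI).eventually_mem hW).and
      ((h₂.continuousOn t htI).eventually_mem (heq ▸ hW))
  have hev' : ∀ᶠ s in 𝓝[≥] t, s ∈ Icc 0 τ ∧
      γ₁ s ∈ (cotangentChart E x₀).source ∩ cotangentChart E x₀ ⁻¹' u ∧
      γ₂ s ∈ (cotangentChart E x₀).source ∩ cotangentChart E x₀ ⁻¹' u := by
    have hle : 𝓝[≥] t ≤ 𝓝[Icc 0 τ] t :=
      nhdsWithin_le_iff.2 (mem_of_superset (Icc_mem_nhdsGE ht.2)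
        (Icc_subset_Icc_left ht.1))
    exact (eventually_mem_nhdsWithin.and hev).filter_mono hle
  obtain ⟨b, hb, hbs⟩ := (mem_nhdsGE_iff_exists_Icc_subset).1 hev'
  have hder : ∀ γ : ℝ → Cotangent E N, IsHamiltonianTrajectory H τ γ →
      (∀ s ∈ Icc t b, γ s ∈ (cotangentChart E x₀).source) →
        ContinuousOn (cotangentChart E x₀ ∘ γ) (Icc t b) ∧
      ∀ s ∈ Ico t b, HasDerivWithinAt (cotangentChart E x₀ ∘ γ)
        (hamiltonianField (H ∘ (cotangentChart E x₀).symm) (cotangentChart E x₀ (γ s)))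
        (Ici s) s := by
    intro γ hγ hs
    have hd : ∀ s ∈ Icc t b, _ := fun s hsI ↦ hγ.hasDerivWithinAt (hbs hsI).1
      (mem_cotangentChart_source.1 (hs s hsI))
    refine ⟨fun s hsI ↦ ((hd s hsI).mono fun r hr ↦ (hbs hr).1).continuousWithinAt,
      fun s hsI ↦ (hd s (Ico_subset_Icc_self hsI)).mono_of_mem_nhdsWithin ?_⟩
    refine mem_of_superset (Icc_mem_nhdsGE hsI.2) fun r hr ↦ (hbs ⟨hsI.1.trans hr.1, hr.2⟩).1
  obtain ⟨hc1, hd1⟩ := hder γ₁ h₁ fun s hs ↦ (hbs hs).2.1.1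
  obtain ⟨hc2, hd2⟩ := hder γ₂ h₂ fun s hs ↦ (hbs hs).2.2.1
  have hEq := ODE_solution_unique_of_mem_Icc_right (K := C) (s := fun _ ↦ u)
    (v := fun _ ↦ hamiltonianField (H ∘ (cotangentChart E x₀).symm)) (fun _ _ ↦ hC) hc1 hd1
    (fun s hs ↦ (hbs (Ico_subset_Icc_self hs)).2.1.2) hc2 hd2
    (fun s hs ↦ (hbs (Ico_subset_Icc_self hs)).2.2.2) (congrArg (cotangentChart E x₀) heq)
  have hm : min b y ∈ Icc t b := ⟨le_min hb.le (le_of_lt hy), min_le_left _ _⟩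
  exact ⟨min b y, (cotangentChart E x₀).injOn (hbs hm).2.1.1 (hbs hm).2.2.1 (hEq hm),
    lt_min hb hy, min_le_right _ _⟩

/-- `hamiltonianFlow` evaluates an arbitrarily chosen trajectory; uniqueness lets any explicit one
compute it. -/
theorem hamiltonianFlow_eq [T2Space N] {H : Cotangent E N → ℝ} {τ : ℝ} (hτ : 0 ≤ τ)
    {γ : ℝ → Cotangent E N} (hγ : IsHamiltonianTrajectory H τ γ) :
    hamiltonianFlow H τ (γ 0) = γ τ := by
  have h : FlowDefined H τ (γ 0) := ⟨γ, hγ, rfl⟩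
  rw [hamiltonianFlow, dif_pos h]
  exact h.choose_spec.1.eqOn hγ h.choose_spec.2 ⟨hτ, le_rfl⟩

end Trajectory

/-! ## The reduced Hamiltonian in canonical coordinates -/

section ReducedHamiltonian

variable {EM EN : Type*} [NormedAddCommGroup EM] [NormedSpace ℝ EM]
  [NormedAddCommGroup EN] [NormedSpace ℝ EN]
  {M : Type*} [TopologicalSpace M] [ChartedSpace EM M]
  {N : Type*} [TopologicalSpace N] [ChartedSpace EN N] [IsManifold 𝓘(ℝ, EN) ∞ N]
  {ρ : M → N} {X₀ : ∀ y : M, TangentSpace 𝓘(ℝ, EM) y}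

variable (EM EN) in
/-- The derivative of a map between manifolds, read in the preferred charts. -/
def chartDeriv {M N : Type*} [TopologicalSpace M] [ChartedSpace EM M]
    [TopologicalSpace N] [ChartedSpace EN N] (f : M → N) (y : M) : EM →L[ℝ] EN :=
  mfderiv 𝓘(ℝ, EM) 𝓘(ℝ, EN) f y

/-- The velocity `dρ (X₀ y)` in the preferred chart of `N` at `x₀`. -/
def chartDrift (ρ : M → N) (X₀ : ∀ y : M, TangentSpace 𝓘(ℝ, EM) y) (x₀ : N) (y : M) : EN :=
  chartDeriv EM EN (chartAt EN x₀ ∘ ρ) y (X₀ y)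

omit [IsManifold 𝓘(ℝ, EN) ∞ N] in
theorem hasMFDerivAt_chartDeriv {f : M → N} {y : M}
    (hf : MDifferentiableAt 𝓘(ℝ, EM) 𝓘(ℝ, EN) f y) :
    HasMFDerivAt 𝓘(ℝ, EM) 𝓘(ℝ, EN) f y (chartDeriv EM EN f y) := hf.hasMFDerivAt

omit [IsManifold 𝓘(ℝ, EN) ∞ N] in
theorem chartDeriv_eq {f : M → N} {y : M} {L : EM →L[ℝ] EN}
    (hf : HasMFDerivAt 𝓘(ℝ, EM) 𝓘(ℝ, EN) f y L) : chartDeriv EM EN f y = L := hf.mfderiv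

omit [IsManifold 𝓘(ℝ, EN) ∞ N] in
-- Removes the cast along `ρ y = p.proj`, so that later arguments deal with maps between fixed
-- vector spaces.
theorem mem_fibreValues {p : Cotangent EN N} {r : ℝ} :
    r ∈ fibreValues ρ X₀ p ↔ ∃ y, ρ y = p.proj ∧
      r = covector p (chartDeriv EM EN ρ y (X₀ y)) := by
  obtain ⟨x, l⟩ := p
  constructor
  · rintro ⟨y, h, rfl⟩
    change ρ y = x at h
    subst h
    exact ⟨y, rfl, rfl⟩
  · rintro ⟨y, h, rfl⟩
    change ρ y = x at h
    subst h
    exact ⟨y, rfl, rfl⟩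

theorem chartDeriv_chartAt_comp {x₀ : N} {y : M}
    (hρ : MDifferentiableAt 𝓘(ℝ, EM) 𝓘(ℝ, EN) ρ y) (hy : ρ y ∈ (chartAt EN x₀).source) :
    chartDeriv EM EN (chartAt EN x₀ ∘ ρ) y =
      (tangentCoordChange 𝓘(ℝ, EN) (ρ y) x₀ (ρ y)).comp (chartDeriv EM EN ρ y) := by
  have h := (mdifferentiableAt_atlas (I := 𝓘(ℝ, EN)) (chart_mem_atlas EN x₀) hy).hasMFDerivAt
  rw [mfderiv_chartAt_eq_tangentCoordChange hy] at h
  exact chartDeriv_eq (HasMFDerivAt.comp y h hρ.hasMFDerivAt)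

/-- The values of a covector on the fibre, in canonical coordinates. -/
theorem mem_fibreValues_cotangentChart_symm (hρ : MDifferentiable 𝓘(ℝ, EM) 𝓘(ℝ, EN) ρ) {x₀ : N}
    {z : EN × (EN →L[ℝ] ℝ)} (hz : z.1 ∈ (chartAt EN x₀).target) {r : ℝ} :
    r ∈ fibreValues ρ X₀ ((cotangentChart EN x₀).symm z) ↔
      ∃ y, ρ y = (chartAt EN x₀).symm z.1 ∧ r = z.2 (chartDrift ρ X₀ x₀ y) := by
  have hproj := cotangentChart_symm_proj hz
  have hz' := mem_cotangentChart_target.2 hz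
  have hp := mem_cotangentChart_source.1 ((cotangentChart EN x₀).map_target hz')
  have h2 := cotangentChart_apply hp
  rw [(cotangentChart EN x₀).right_inv hz'] at h2
  rw [mem_fibreValues]
  refine exists_congr fun y ↦ ?_
  rw [hproj]
  refine and_congr_right fun hy ↦ ?_
  rw [← hproj] at hy
  rw [chartDrift, chartDeriv_chartAt_comp (hρ y) (hy ▸ hp)]
  set w : EN := chartDeriv EM EN ρ y (X₀ y)
  have h3 : z.2 = (covector ((cotangentChart EN x₀).symm z)).comp (tangentCoordChange 𝓘(ℝ, EN) x₀
      ((cotangentChart EN x₀).symm z).proj ((cotangentChart EN x₀).symm z).proj) :=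
    congrArg Prod.snd h2
  rw [h3, hy]
  have h4 : tangentCoordChange 𝓘(ℝ, EN) x₀
      ((cotangentChart EN x₀).symm z).proj ((cotangentChart EN x₀).symm z).proj
      (tangentCoordChange 𝓘(ℝ, EN) ((cotangentChart EN x₀).symm z).proj x₀
        ((cotangentChart EN x₀).symm z).proj w) = w := by
    rw [tangentCoordChange_comp, tangentCoordChange_self]
    · exact mem_extChartAt_source (I := 𝓘(ℝ, EN)) ((cotangentChart EN x₀).symm z).proj
    · simp only [extChartAt_source]
      exact ⟨⟨mem_chart_source EN ((cotangentChart EN x₀).symm z).proj, hp⟩,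
        mem_chart_source EN ((cotangentChart EN x₀).symm z).proj⟩
  change r = covector ((cotangentChart EN x₀).symm z) w ↔
    r = covector ((cotangentChart EN x₀).symm z) (tangentCoordChange 𝓘(ℝ, EN) x₀
      ((cotangentChart EN x₀).symm z).proj ((cotangentChart EN x₀).symm z).proj
      (tangentCoordChange 𝓘(ℝ, EN) ((cotangentChart EN x₀).symm z).proj x₀
        ((cotangentChart EN x₀).symm z).proj w))
  rw [h4]

omit [IsManifold 𝓘(ℝ, EN) ∞ N] in
theorem isGreatest_reducedHamiltonian
    (hmax : ∀ p : Cotangent EN N, ∃ r, IsGreatest (fibreValues ρ X₀ p) r) (p : Cotangent EN N) :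
    IsGreatest (fibreValues ρ X₀ p) (reducedHamiltonian ρ X₀ p) := by
  obtain ⟨r, hr⟩ := hmax p
  rwa [reducedHamiltonian, hr.csSup_eq]

/-- The domination of velocities by the Hamiltonian; every comparison with admissible curves rests
on it. -/
theorem apply_chartDrift_le (hρ : MDifferentiable 𝓘(ℝ, EM) 𝓘(ℝ, EN) ρ)
    (hmax : ∀ p : Cotangent EN N, ∃ r, IsGreatest (fibreValues ρ X₀ p) r) {x₀ : N} {y : M}
    (hy : ρ y ∈ (chartAt EN x₀).source) (l : EN →L[ℝ] ℝ) :
    l (chartDrift ρ X₀ x₀ y) ≤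
      (reducedHamiltonian ρ X₀ ∘ (cotangentChart EN x₀).symm) (chartAt EN x₀ (ρ y), l) := by
  refine (isGreatest_reducedHamiltonian hmax _).2 ?_
  rw [mem_fibreValues_cotangentChart_symm hρ ((chartAt EN x₀).map_source hy)]
  exact ⟨y, ((chartAt EN x₀).left_inv hy).symm, rfl⟩

theorem reducedHamiltonian_smul (hρ : MDifferentiable 𝓘(ℝ, EM) 𝓘(ℝ, EN) ρ)
    (hmax : ∀ p : Cotangent EN N, ∃ r, IsGreatest (fibreValues ρ X₀ p) r) {x₀ : N} {q : EN}
    (hq : q ∈ (chartAt EN x₀).target) (l : EN →L[ℝ] ℝ) (c : ℝ) (hc : 0 < c) :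
    (reducedHamiltonian ρ X₀ ∘ (cotangentChart EN x₀).symm) (q, c • l) =
      c * (reducedHamiltonian ρ X₀ ∘ (cotangentChart EN x₀).symm) (q, l) := by
  have h1 := isGreatest_reducedHamiltonian hmax ((cotangentChart EN x₀).symm (q, l))
  refine (isGreatest_reducedHamiltonian hmax _).unique ⟨?_, fun r hr ↦ ?_⟩
  · have := h1.1
    rw [mem_fibreValues_cotangentChart_symm hρ hq] at this ⊢
    obtain ⟨y, hy, hr⟩ := this
    exact ⟨y, hy, by simp [hr]⟩
  · rw [mem_fibreValues_cotangentChart_symm hρ hq] at hr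
    obtain ⟨y, hy, rfl⟩ := hr
    exact mul_le_mul_of_nonneg_left
      (h1.2 ((mem_fibreValues_cotangentChart_symm hρ hq).2 ⟨y, hy, rfl⟩)) hc.le

theorem reducedHamiltonian_add_le (hρ : MDifferentiable 𝓘(ℝ, EM) 𝓘(ℝ, EN) ρ)
    (hmax : ∀ p : Cotangent EN N, ∃ r, IsGreatest (fibreValues ρ X₀ p) r) {x₀ : N} {q : EN}
    (hq : q ∈ (chartAt EN x₀).target) (l m : EN →L[ℝ] ℝ) :
    (reducedHamiltonian ρ X₀ ∘ (cotangentChart EN x₀).symm) (q, l + m) ≤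
      (reducedHamiltonian ρ X₀ ∘ (cotangentChart EN x₀).symm) (q, l) +
      (reducedHamiltonian ρ X₀ ∘ (cotangentChart EN x₀).symm) (q, m) := by
  have h := (isGreatest_reducedHamiltonian hmax ((cotangentChart EN x₀).symm (q, l + m))).1
  rw [mem_fibreValues_cotangentChart_symm hρ hq] at h
  obtain ⟨y, hy, hr⟩ := h
  simp only [Function.comp_apply]
  rw [hr]
  exact add_le_add ((isGreatest_reducedHamiltonian hmax _).2
      ((mem_fibreValues_cotangentChart_symm hρ hq).2 ⟨y, hy, rfl⟩))
    ((isGreatest_reducedHamiltonian hmax _).2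
      ((mem_fibreValues_cotangentChart_symm hρ hq).2 ⟨y, hy, rfl⟩))

/-- The velocities of the reduced system are bounded over compact sets. -/
theorem exists_chartDrift_bound [FiniteDimensional ℝ EN]
    (hρ : MDifferentiable 𝓘(ℝ, EM) 𝓘(ℝ, EN) ρ)
    (hmax : ∀ p : Cotangent EN N, ∃ r, IsGreatest (fibreValues ρ X₀ p) r)
    (hbdd : ∀ C : Set (Cotangent EN N), IsCompact C → BddAbove (reducedHamiltonian ρ X₀ '' C))
    {x₀ : N} {B : Set EN} (hB : IsCompact B) (hBt : B ⊆ (chartAt EN x₀).target) :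
    ∃ V : ℝ, 0 ≤ V ∧ ∀ y, ρ y ∈ (chartAt EN x₀).source → chartAt EN x₀ (ρ y) ∈ B →
      ‖(chartDrift ρ X₀ x₀ y : EN)‖ ≤ V := by
  have hC : IsCompact ((cotangentChart EN x₀).symm ''
      (B ×ˢ Metric.closedBall (0 : EN →L[ℝ] ℝ) 1)) := by
    refine (hB.prod (isCompact_closedBall _ _)).image_of_continuousOn
      ((cotangentChart EN x₀).continuousOn_symm.mono fun z hz ↦ ?_)
    exact mem_cotangentChart_target.2 (hBt hz.1)
  obtain ⟨V, hV⟩ := hbdd _ hC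
  refine ⟨max V 0, le_max_right V 0, fun y hy hyB ↦ ?_⟩
  -- A norming functional turns the one-sided bound for the Hamiltonian over the unit ball of
  -- covectors into a bound for the norm.
  obtain ⟨l, hl, hle⟩ := exists_dual_vector'' ℝ (chartDrift ρ X₀ x₀ y : EN)
  have h := apply_chartDrift_le (X₀ := X₀) hρ hmax hy l
  rw [hle] at h
  refine le_trans (le_trans h (hV ⟨_, ⟨(_, l), ⟨hyB, ?_⟩, rfl⟩, rfl⟩)) (le_max_left _ _)
  simpa using hl

end ReducedHamiltonian

/-! ## Admissible pairs in a chart of the base -/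

section Admissible

variable {EM EG EN : Type*}
    [NormedAddCommGroup EM] [NormedSpace ℝ EM]
    [NormedAddCommGroup EG] [NormedSpace ℝ EG]
    [NormedAddCommGroup EN] [NormedSpace ℝ EN]
    {M : Type*} [TopologicalSpace M]
    [ChartedSpace EM M] [IsManifold 𝓘(ℝ, EM) ∞ M]
    {N : Type*} [TopologicalSpace N]
    [ChartedSpace EN N] [IsManifold 𝓘(ℝ, EN) ∞ N]
    {G : Type*} [TopologicalSpace G] [ChartedSpace EG G] [CommGroup G] [MulAction G M]
    {ρ : M → N} {k : ℕ} {ξ : Fin k → TangentSpace 𝓘(ℝ, EG) (1 : G)}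
    {X₀ : ∀ y : M, TangentSpace 𝓘(ℝ, EM) y}

omit [IsManifold 𝓘(ℝ, EM) ∞ M] [IsManifold 𝓘(ℝ, EN) ∞ N] in
theorem IsPrincipalBundle.mdifferentiable (hρ : IsPrincipalBundle EM EG EN G ρ) :
    MDifferentiable 𝓘(ℝ, EM) 𝓘(ℝ, EN) ρ := hρ.contMDiff_proj.mdifferentiable (by simp)

omit [IsManifold 𝓘(ℝ, EM) ∞ M] [IsManifold 𝓘(ℝ, EN) ∞ N] in
/-- The fundamental fields are vertical. -/
theorem IsPrincipalBundle.mfderiv_fundamentalField (hρ : IsPrincipalBundle EM EG EN G ρ)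
    (ζ : TangentSpace 𝓘(ℝ, EG) (1 : G)) (y : M) :
    chartDeriv EM EN ρ y (fundamentalField ζ y) = 0 := by
  have h1 : MDifferentiableAt 𝓘(ℝ, EG) 𝓘(ℝ, EM) (fun g : G ↦ g • y) 1 := by
    have h2 := (hρ.contMDiff_smul.comp (contMDiff_id.prodMk contMDiff_const) :
      ContMDiff 𝓘(ℝ, EG) 𝓘(ℝ, EM) ∞ fun g : G ↦ g • y)
    exact h2.mdifferentiable (by simp) 1
  have h3 : HasMFDerivAt 𝓘(ℝ, EM) 𝓘(ℝ, EN) ρ ((1 : G) • y)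
      (chartDeriv EM EN ρ y) := by
    rw [one_smul]
    exact hasMFDerivAt_chartDeriv (hρ.mdifferentiable y)
  have h4 := HasMFDerivAt.comp (1 : G) h3 h1.hasMFDerivAt
  have h5 : (ρ ∘ fun g : G ↦ g • y) = fun _ ↦ ρ y := funext fun g ↦ hρ.proj_smul g y
  rw [h5] at h4
  have h6 := hasMFDerivAt_unique h4 (hasMFDerivAt_const (ρ y) (1 : G))
  exact congrArg (fun L : EG →L[ℝ] EN ↦ L ζ) h6

omit [IsManifold 𝓘(ℝ, EM) ∞ M] in
-- Vertical fields are killed by the projection, so the control disappears: however large it is, it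
-- does not directly affect the speed on the base.
theorem IsPrincipalBundle.chartDeriv_rescaledSystem (hρ : IsPrincipalBundle EM EG EN G ρ)
    {x₀ : N} {y : M} (hy : ρ y ∈ (chartAt EN x₀).source) (ε : ℝ) (u : EuclideanSpace ℝ (Fin k)) :
    chartDeriv EM EN (chartAt EN x₀ ∘ ρ) y
      (rescaledSystem X₀ (fun i ↦ fundamentalField (ξ i)) ε y u) =
      ε • chartDrift ρ X₀ x₀ y := by
  have hv : ∀ ζ : TangentSpace 𝓘(ℝ, EG) (1 : G),
      chartDeriv EM EN (chartAt EN x₀ ∘ ρ) y (fundamentalField ζ y) = 0 := fun ζ ↦ by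
    rw [chartDeriv_chartAt_comp (hρ.mdifferentiable y) hy]
    exact (congrArg (tangentCoordChange 𝓘(ℝ, EN) (ρ y) x₀ (ρ y))
      (hρ.mfderiv_fundamentalField ζ y)).trans (map_zero _)
  let D : EM := X₀ y
  let V : Fin k → EM := fun i ↦ fundamentalField (ξ i) y
  change chartDeriv EM EN (chartAt EN x₀ ∘ ρ) y (ε • D + ∑ i, u i • V i) = _
  rw [map_add, map_smul, map_sum, Finset.sum_eq_zero fun i _ ↦ ?_, add_zero]
  · rfl
  · rw [map_smul]
    exact (congrArg (u i • ·) (hv (ξ i))).trans (smul_zero _)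

omit [IsManifold 𝓘(ℝ, EM) ∞ M] in
theorem IsLipschitzCurve.locallyLipschitzOn {γ : ℝ → M} (hγ : IsLipschitzCurve (EM := EM) γ)
    {F : Type*} [NormedAddCommGroup F] [NormedSpace ℝ F] {g : M → F} {s : Set ℝ}
    (hs : s ⊆ Icc 0 1) (hg : ∀ t ∈ s, ContMDiffAt 𝓘(ℝ, EM) 𝓘(ℝ, F) 1 g (γ t)) :
    LocallyLipschitzOn s (g ∘ γ) := by
  intro t ht
  obtain ⟨C, u, hu, hC⟩ := hγ.2 t (hs ht)
  have hgd : ContDiffAt ℝ 1 (g ∘ (extChartAt 𝓘(ℝ, EM) (γ t)).symm)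
      (extChartAt 𝓘(ℝ, EM) (γ t) (γ t)) := by
    have := (contMDiffAt_iff.1 (hg t ht)).2
    simpa [mfld_simps, contDiffWithinAt_univ, chartAt_self_eq] using this
  obtain ⟨D, v, hv, hD⟩ := exists_lipschitzOnWith_comp_contDiffAt (hs ht) ⟨C, u, hu, hC⟩ hgd
  have hsrc : ∀ᶠ r in 𝓝[Icc 0 1] t, γ r ∈ (extChartAt 𝓘(ℝ, EM) (γ t)).source :=
    (hγ.1 t (hs ht)).eventually_mem (extChartAt_source_mem_nhds (γ t))
  refine ⟨D, v ∩ {r | γ r ∈ (extChartAt 𝓘(ℝ, EM) (γ t)).source},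
    nhdsWithin_mono t hs (inter_mem hv hsrc), ?_⟩
  intro a ha b hb
  have := hD ha.1 hb.1
  simp only [Function.comp_apply] at this
  rwa [(extChartAt 𝓘(ℝ, EM) (γ t)).left_inv ha.2,
    (extChartAt 𝓘(ℝ, EM) (γ t)).left_inv hb.2] at this

omit [IsManifold 𝓘(ℝ, EM) ∞ M] in
theorem IsPrincipalBundle.contMDiffAt_chartAt_comp (hρ : IsPrincipalBundle EM EG EN G ρ)
    {x₀ : N} {y : M} (hy : ρ y ∈ (chartAt EN x₀).source) :
    ContMDiffAt 𝓘(ℝ, EM) 𝓘(ℝ, EN) ∞ (chartAt EN x₀ ∘ ρ) y :=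
  ((contMDiffOn_chart (I := 𝓘(ℝ, EN)) (n := ∞) (x := x₀)).contMDiffAt
    ((chartAt EN x₀).open_source.mem_nhds hy)).comp y (hρ.contMDiff_proj y)

omit [IsManifold 𝓘(ℝ, EM) ∞ M] in
theorem IsAdmissiblePair.locallyLipschitzOn_chart (hρ : IsPrincipalBundle EM EG EN G ρ)
    {F : ∀ y : M, EuclideanSpace ℝ (Fin k) → TangentSpace 𝓘(ℝ, EM) y}
    {γ : ℝ → M} {u : ℝ → EuclideanSpace ℝ (Fin k)} (h : IsAdmissiblePair F γ u) {x₀ : N}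
    {s : Set ℝ} (hs : s ⊆ Icc 0 1) (hsrc : ∀ t ∈ s, ρ (γ t) ∈ (chartAt EN x₀).source) :
    LocallyLipschitzOn s fun t ↦ chartAt EN x₀ (ρ (γ t)) :=
  h.lipschitz.locallyLipschitzOn (g := chartAt EN x₀ ∘ ρ) hs fun t ht ↦
    (hρ.contMDiffAt_chartAt_comp (hsrc t ht)).of_le (WithTop.coe_le_coe.2 le_top)

omit [IsManifold 𝓘(ℝ, EM) ∞ M] in
theorem IsAdmissiblePair.ae_hasDerivAt_chart (hρ : IsPrincipalBundle EM EG EN G ρ) {ε : ℝ}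
    {γ : ℝ → M} {u : ℝ → EuclideanSpace ℝ (Fin k)}
    (h : IsAdmissiblePair (rescaledSystem X₀ (fun i ↦ fundamentalField (ξ i)) ε) γ u) (x₀ : N) :
    ∀ᵐ t ∂volume.restrict (Icc (0 : ℝ) 1), ρ (γ t) ∈ (chartAt EN x₀).source →
      HasDerivAt (fun t ↦ chartAt EN x₀ (ρ (γ t))) (ε • chartDrift ρ X₀ x₀ (γ t)) t := by
  filter_upwards [h.ode] with t ht hsrc
  have h1 := hasMFDerivAt_chartDeriv
    ((hρ.contMDiffAt_chartAt_comp hsrc).mdifferentiableAt (by simp))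
  let W : EM := rescaledSystem X₀ (fun i ↦ fundamentalField (ξ i)) ε (γ t) (u t)
  have h2 : HasFDerivAt (fun t ↦ chartAt EN x₀ (ρ (γ t)))
      ((chartDeriv EM EN (chartAt EN x₀ ∘ ρ) (γ t)).comp
        ((1 : ℝ →L[ℝ] ℝ).smulRight W)) t :=
    (HasMFDerivAt.comp t h1 ht).hasFDerivAt
  refine h2.hasDerivAt.congr_deriv ?_
  rw [← hρ.chartDeriv_rescaledSystem hsrc ε (u t)]
  change chartDeriv EM EN (chartAt EN x₀ ∘ ρ) (γ t) ((1 : ℝ) • W) = _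
  rw [one_smul]

omit [IsManifold 𝓘(ℝ, EM) ∞ M] in
/-- For small `ε`, the projections to the base of the admissible trajectories stay near their
initial points. -/
theorem exists_confinement [FiniteDimensional ℝ EN] [T2Space N]
    (hρ : IsPrincipalBundle EM EG EN G ρ)
    (hmax : ∀ p : Cotangent EN N, ∃ r, IsGreatest (fibreValues ρ X₀ p) r)
    (hbdd : ∀ C : Set (Cotangent EN N), IsCompact C → BddAbove (reducedHamiltonian ρ X₀ '' C))
    (x₀ : N) {O : Set N} (hO : O ∈ 𝓝 x₀) :
    ∃ U ∈ 𝓝 x₀, ∃ δ > 0, ∀ ε ∈ Ioo 0 δ, ∀ (γ : ℝ → M) (u : ℝ → EuclideanSpace ℝ (Fin k)),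
      IsAdmissiblePair (rescaledSystem X₀ (fun i ↦ fundamentalField (ξ i)) ε) γ u →
      ρ (γ 0) ∈ U → ∀ t ∈ Icc (0 : ℝ) 1, ρ (γ t) ∈ O := by
  set ψ := chartAt EN x₀ with hψ
  have hx₀ : x₀ ∈ ψ.source := mem_chart_source EN x₀
  have hnh : ψ.target ∩ ψ.symm ⁻¹' O ∈ 𝓝 (ψ x₀) :=
    inter_mem (ψ.open_target.mem_nhds (ψ.map_source hx₀))
      (ψ.continuousAt_symm (ψ.map_source hx₀) (by rwa [ψ.left_inv hx₀]))
  obtain ⟨r, hr, hball⟩ := Metric.nhds_basis_closedBall.mem_iff.1 hnh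
  have htar : Metric.closedBall (ψ x₀) r ⊆ ψ.target := fun q hq ↦ (hball hq).1
  have hcomp := isCompact_closedBall (ψ x₀) r
  obtain ⟨V, hV0, hV⟩ := exists_chartDrift_bound (X₀ := X₀) (ρ := ρ) hρ.mdifferentiable hmax hbdd
    hcomp htar
  -- Compact in a Hausdorff space, hence closed: at the exit time the curve is still in the domain
  -- of the chart.
  set D := ψ.symm '' Metric.closedBall (ψ x₀) r
  have hD : IsClosed D :=
    (hcomp.image_of_continuousOn (ψ.continuousOn_symm.mono htar)).isClosed
  have hDsrc : ∀ x ∈ D, x ∈ ψ.source ∧ ψ x ∈ Metric.closedBall (ψ x₀) r := by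
    rintro _ ⟨q, hq, rfl⟩
    exact ⟨ψ.map_target (htar hq), by rwa [ψ.right_inv (htar hq)]⟩
  set W := ψ.source ∩ ψ ⁻¹' Metric.ball (ψ x₀) r
  have hW : IsOpen W := ψ.isOpen_inter_preimage Metric.isOpen_ball
  have hWD : W ⊆ D := fun x hx ↦ ⟨ψ x, Metric.ball_subset_closedBall hx.2, ψ.left_inv hx.1⟩
  have hWO : W ⊆ O := fun x hx ↦ by
    have := (hball (Metric.ball_subset_closedBall hx.2)).2
    rwa [mem_preimage, ψ.left_inv hx.1] at this
  refine ⟨ψ.source ∩ ψ ⁻¹' Metric.ball (ψ x₀) (r / 2),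
    (ψ.isOpen_inter_preimage Metric.isOpen_ball).mem_nhds
      ⟨hx₀, Metric.mem_ball_self (half_pos hr)⟩,
    r / (2 * (V + 1)), by positivity, fun ε hε γ u hγ h0 ↦ ?_⟩
  have hεV : ε * V < r / 2 := by
    have := hε.2
    rw [lt_div_iff₀ (by positivity)] at this
    nlinarith [hε.1]
  have hcont : ContinuousOn (ρ ∘ γ) (Icc 0 1) :=
    hρ.contMDiff_proj.continuous.comp_continuousOn hγ.lipschitz.1
  suffices h : ∀ t ∈ Icc (0 : ℝ) 1, ρ (γ t) ∈ W from fun t ht ↦ hWO (h t ht)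
  by_contra! hcon
  obtain ⟨t₁, ht₁, hnot⟩ := hcon
  have hZ : IsCompact (Icc (0 : ℝ) 1 ∩ (ρ ∘ γ) ⁻¹' Wᶜ) :=
    isCompact_Icc.of_isClosed_subset
      (hcont.preimage_isClosed_of_isClosed isClosed_Icc hW.isClosed_compl) inter_subset_left
  -- `T` is the first exit time from `W`. Up to `T` the speed is at most `ε * V < r / 2`, so a curve
  -- starting in the half ball cannot have left.
  obtain ⟨T, ⟨hTI, hTW⟩, hleast⟩ := hZ.exists_isLeast ⟨t₁, ht₁, hnot⟩
  have hbefore : ∀ t ∈ Ico 0 T, ρ (γ t) ∈ W := fun t ht ↦ by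
    by_contra hc
    exact absurd (hleast ⟨⟨ht.1, ht.2.le.trans hTI.2⟩, hc⟩) (not_le.2 ht.2)
  have hT0 : 0 < T := by
    refine lt_of_le_of_ne hTI.1 fun h ↦ hTW ?_
    rw [← h]
    exact ⟨h0.1, Metric.ball_subset_ball (half_le_self hr.le) h0.2⟩
  have hTD : ρ (γ T) ∈ D := by
    rw [← hD.closure_eq]
    refine ContinuousWithinAt.mem_closure (f := ρ ∘ γ) (s := Ico 0 T)
      ((hcont T hTI).mono fun t ht ↦ ⟨ht.1, ht.2.le.trans hTI.2⟩) ?_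
      fun t ht ↦ hWD (hbefore t ht)
    rw [closure_Ico hT0.ne]
    exact right_mem_Icc.2 hT0.le
  have hall : ∀ t ∈ Icc 0 T, ρ (γ t) ∈ D := fun t ht ↦ by
    rcases ht.2.lt_or_eq with h | h
    · exact hWD (hbefore t ⟨ht.1, h⟩)
    · rwa [h]
  have hsub : Icc 0 T ⊆ Icc 0 1 := Icc_subset_Icc_right hTI.2
  -- A functional norming the displacement reduces the speed estimate to the monotonicity of the
  -- scalar function `l(ψ(ρ(γ t))) - ε V t`.
  obtain ⟨l, hl, hle⟩ := exists_dual_vector'' ℝ (ψ (ρ (γ T)) - ψ (ρ (γ 0)))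
  have hmono : l (ψ (ρ (γ T))) - ε * V * T ≤ l (ψ (ρ (γ 0))) - ε * V * 0 := by
    refine LocallyLipschitzOn.le_of_ae_deriv_nonpos
      (f := fun t ↦ l (ψ (ρ (γ t))) - ε * V * t) hT0.le ?_ ?_
    · have h1 := hγ.locallyLipschitzOn_chart hρ hsub fun t ht ↦ (hDsrc _ (hall t ht)).1
      have hid : LocallyLipschitzOn (Icc (0 : ℝ) T) fun t : ℝ ↦ t :=
        (LipschitzWith.id.locallyLipschitz).locallyLipschitzOn
      exact (h1.prodMk hid).contDiffAt_comp (g := fun z : EN × ℝ ↦ l z.1 - ε * V * z.2)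
        fun t _ ↦ by fun_prop
    · have hae := ae_restrict_of_ae_restrict_of_subset hsub (hγ.ae_hasDerivAt_chart hρ x₀)
      filter_upwards [hae, ae_restrict_mem measurableSet_Icc] with t hd ht
      obtain ⟨hs, hb⟩ := hDsrc _ (hall t ht)
      have hd' := (l.hasFDerivAt.comp_hasDerivAt t (hd hs)).sub
        ((hasDerivAt_id t).const_mul (ε * V))
      refine ⟨_, ?_, hd'⟩
      rw [map_smul, smul_eq_mul, mul_one]
      have h2 : l (chartDrift ρ X₀ x₀ (γ t)) ≤ V :=
        calc l (chartDrift ρ X₀ x₀ (γ t)) ≤ ‖l (chartDrift ρ X₀ x₀ (γ t))‖ := le_abs_self _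
          _ ≤ ‖l‖ * ‖chartDrift ρ X₀ x₀ (γ t)‖ := l.le_opNorm _
          _ ≤ 1 * V := mul_le_mul hl (hV _ hs hb) (norm_nonneg _) zero_le_one
          _ = V := one_mul V
      have := mul_le_mul_of_nonneg_left h2 hε.1.le
      linarith
  rw [map_sub] at hle
  have hTle : ε * V * T ≤ ε * V := mul_le_of_le_one_right (mul_nonneg hε.1.le hV0) hTI.2
  have hnorm : ‖ψ (ρ (γ T)) - ψ (ρ (γ 0))‖ < r / 2 := by
    have hle' : l (ψ (ρ (γ T))) - l (ψ (ρ (γ 0))) = ‖ψ (ρ (γ T)) - ψ (ρ (γ 0))‖ := hle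
    linarith
  refine hTW ⟨(hDsrc _ hTD).1, ?_⟩
  have h2 := h0.2
  rw [mem_preimage, Metric.mem_ball] at h2 ⊢
  rw [← dist_eq_norm] at hnorm
  change dist (ψ (ρ (γ T))) (ψ x₀) < r
  linarith [dist_triangle (ψ (ρ (γ T))) (ψ (ρ (γ 0))) (ψ x₀)]

end Admissible

/-! ### Projected characteristics as dominated curves -/

section Characteristics

variable {E : Type*} [NormedAddCommGroup E] [NormedSpace ℝ E] [FiniteDimensional ℝ E]

/-- The projections of the characteristics of a sublinear Hamiltonian have velocities dominated by
the Hamiltonian. -/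
theorem characteristic_dominated {h : E × (E →L[ℝ] ℝ) → ℝ} {ε : ℝ} (hε : 0 < ε)
    {β : ℝ → E × (E →L[ℝ] ℝ)}
    (hC : ∀ t ∈ Icc 0 ε, ContDiffAt ℝ 2 h (β t))
    (hd : ∀ t ∈ Icc 0 ε, HasDerivWithinAt β (hamiltonianField h (β t)) (Icc 0 ε) t)
    (hhom : ∀ t ∈ Icc 0 ε, ∀ (l : E →L[ℝ] ℝ) (c : ℝ), 0 < c →
      h ((β t).1, c • l) = c * h ((β t).1, l))
    (hsub : ∀ t ∈ Icc 0 ε, ∀ l m : E →L[ℝ] ℝ,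
      h ((β t).1, l + m) ≤ h ((β t).1, l) + h ((β t).1, m)) :
    LocallyLipschitzOn (Icc 0 1) (fun t ↦ (β (ε * t)).1) ∧
      ∀ᵐ t ∂volume.restrict (Icc (0 : ℝ) 1), ∃ v, HasDerivAt (fun t ↦ (β (ε * t)).1) v t ∧
        ∀ l : E →L[ℝ] ℝ, l v ≤ ε * h ((β (ε * t)).1, l) := by
  have hmaps : ∀ t ∈ Icc (0 : ℝ) 1, ε * t ∈ Icc 0 ε := fun t ht ↦
    ⟨mul_nonneg hε.le ht.1, mul_le_of_le_one_right hε.le ht.2⟩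
  have hd' : ∀ t ∈ Icc (0 : ℝ) 1, HasDerivWithinAt (fun t ↦ (β (ε * t)).1)
      (ε • (hamiltonianField h (β (ε * t))).1) (Icc 0 1) t := fun t ht ↦ by
    have h1 := (hd _ (hmaps t ht)).scomp t (((hasDerivAt_id t).const_mul ε).hasDerivWithinAt)
      (s := Icc 0 1) hmaps
    have h2 := (ContinuousLinearMap.fst ℝ E (E →L[ℝ] ℝ)).hasFDerivAt.comp_hasDerivWithinAt t h1
    refine h2.congr_deriv ?_
    simp
  have hcont : ContinuousOn (fun t ↦ ε • (hamiltonianField h (β (ε * t))).1) (Icc 0 1) := by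
    have h1 : ContinuousOn β (Icc 0 ε) := fun t ht ↦ (hd t ht).continuousWithinAt
    have h2 : ContinuousOn (fun t ↦ hamiltonianField h (β t)) (Icc 0 ε) := fun t ht ↦
      ((hC t ht).hamiltonianField.continuousAt.comp_continuousWithinAt (h1 t ht))
    exact ((h2.comp (continuous_const.mul continuous_id).continuousOn hmaps).fst).const_smul ε
  constructor
  · obtain ⟨C, hCb⟩ := isCompact_Icc.exists_bound_of_continuousOn hcont
    refine fun _ _ ↦ ⟨C.toNNReal, _, self_mem_nhdsWithin,
      Convex.lipschitzOnWith_of_nnnorm_hasDerivWithin_le (convex_Icc 0 1) hd' fun t ht ↦ ?_⟩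
    rw [← NNReal.coe_le_coe, coe_nnnorm]
    exact (hCb t ht).trans (Real.le_coe_toNNReal C)
  · have hae : ∀ᵐ t ∂volume.restrict (Icc (0 : ℝ) 1), t ∈ Ioo (0 : ℝ) 1 := by
      rw [← restrict_Ioo_eq_restrict_Icc]
      exact ae_restrict_mem measurableSet_Ioo
    filter_upwards [hae] with t ht
    have htI := Ioo_subset_Icc_self ht
    refine ⟨_, (hd' t htI).hasDerivAt (Icc_mem_nhds ht.1 ht.2), fun l ↦ ?_⟩
    have h1 := fderiv_le_of_sublinear (hhom _ (hmaps t htI)) (hsub _ (hmaps t htI))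
      (p := (β (ε * t)).2) ((hC _ (hmaps t htI)).differentiableAt (by simp)) l
    rw [fderiv_eq_hamiltonianField] at h1
    rw [map_smul, smul_eq_mul]
    refine mul_le_mul_of_nonneg_left ?_ hε.le
    simpa using h1

end Characteristics

/-! ### Differentials of functions in canonical coordinates -/

section Differential

variable {E : Type*} [NormedAddCommGroup E] [NormedSpace ℝ E]
  {N : Type*} [TopologicalSpace N] [ChartedSpace E N] [IsManifold 𝓘(ℝ, E) ∞ N]

theorem cotangentChart_differentialAt {a : N → ℝ} {x₀ x : N}
    (ha : MDifferentiableAt 𝓘(ℝ, E) 𝓘(ℝ, ℝ) a x) (hx : x ∈ (chartAt E x₀).source) :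
    cotangentChart E x₀ (differentialAt (E := E) a x) =
      (chartAt E x₀ x, fderiv ℝ (a ∘ (chartAt E x₀).symm) (chartAt E x₀ x)) := by
  rw [cotangentChart_apply hx]
  refine Prod.ext rfl ?_
  have hxx := mem_chart_source E x
  have h1 : HasFDerivAt (a ∘ (chartAt E x).symm) (covector (differentialAt (E := E) a x))
      (chartAt E x x) := by
    have := ha.hasMFDerivAt.2
    rw [← hasFDerivWithinAt_univ]
    simp only [mfld_simps] at this
    exact this
  have h2 := ((contDiffAt_chart_transition hx hxx).differentiableAt (by simp)).hasFDerivAt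
  have hval : (chartAt E x ∘ (chartAt E x₀).symm) (chartAt E x₀ x) = chartAt E x x := by
    simp [hx]
  rw [← hval] at h1
  have h3 := h1.comp _ h2
  change (covector (differentialAt (E := E) a x)).comp (tangentCoordChange 𝓘(ℝ, E) x₀ x x) = _
  rw [fderiv_chart_transition]
  refine (HasFDerivAt.fderiv (h3.congr_of_eventuallyEq ?_)).symm
  have hev : ∀ᶠ q in 𝓝 (chartAt E x₀ x), (chartAt E x₀).symm q ∈ (chartAt E x).source := by
    refine ((chartAt E x₀).continuousAt_symm ((chartAt E x₀).map_source hx)).eventually_mem ?_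
    rw [(chartAt E x₀).left_inv hx]
    exact (chartAt E x).open_source.mem_nhds hxx
  filter_upwards [hev] with q hq
  simp [hq]

theorem ContMDiff.contDiffOn_comp_chartAt_symm {a : N → ℝ}
    (ha : ContMDiff 𝓘(ℝ, E) 𝓘(ℝ, ℝ) 2 a) (x₀ : N) :
    ContDiffOn ℝ 2 (a ∘ (chartAt E x₀).symm) (chartAt E x₀).target :=
  (ha.comp_contMDiffOn (contMDiffOn_chart_symm (I := 𝓘(ℝ, E)) (n := 2) (x := x₀))).contDiffOn

/-- A function with nonzero derivative in a chart has nonzero derivative. -/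
theorem exists_hasMFDerivAt_comp_chartAt {f : E → ℝ} {x₀ x : N} (hx : x ∈ (chartAt E x₀).source)
    {p : E →L[ℝ] ℝ} (hf : HasFDerivAt f p (chartAt E x₀ x)) (hp : p ≠ 0) :
    ∃ P : E →L[ℝ] ℝ, P ≠ 0 ∧ HasMFDerivAt 𝓘(ℝ, E) 𝓘(ℝ, ℝ) (f ∘ chartAt E x₀) x P := by
  have h := (mdifferentiableAt_atlas (I := 𝓘(ℝ, E)) (chart_mem_atlas E x₀) hx).hasMFDerivAt
  rw [mfderiv_chartAt_eq_tangentCoordChange hx] at h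
  refine ⟨p.comp (tangentCoordChange 𝓘(ℝ, E) x x₀ x), fun h0 ↦ hp ?_,
    HasMFDerivAt.comp x hf.hasMFDerivAt h⟩
  ext v
  have h1 := congrArg (fun L : E →L[ℝ] ℝ ↦ L (tangentCoordChange 𝓘(ℝ, E) x₀ x x v)) h0
  have h2 : tangentCoordChange 𝓘(ℝ, E) x x₀ x (tangentCoordChange 𝓘(ℝ, E) x₀ x x v) = v := by
    rw [tangentCoordChange_comp, tangentCoordChange_self]
    · simpa using hx
    · simpa using hx
  rw [← h2]
  exact h1

end Differential

/-! ## Local optimality of the projected characteristics -/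

section LocalOptimality

variable {EM EG EN : Type*}
    [NormedAddCommGroup EM] [NormedSpace ℝ EM]
    [NormedAddCommGroup EG] [NormedSpace ℝ EG]
    [NormedAddCommGroup EN] [NormedSpace ℝ EN] [FiniteDimensional ℝ EN]
    {M : Type*} [TopologicalSpace M] [ChartedSpace EM M]
    {N : Type*} [TopologicalSpace N] [T2Space N]
    [ChartedSpace EN N] [IsManifold 𝓘(ℝ, EN) ∞ N]
    {G : Type*} [TopologicalSpace G] [ChartedSpace EG G] [CommGroup G] [MulAction G M]
    {ρ : M → N} {k : ℕ} {ξ : Fin k → TangentSpace 𝓘(ℝ, EG) (1 : G)}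
    {X₀ : ∀ y : M, TangentSpace 𝓘(ℝ, EM) y}

/-- The verification function, moved to the manifold. It is compared with two kinds of dominated
curves: the projected characteristics, which will give injectivity of the flow map, and the
projections of admissible trajectories. Domination by `H` suffices, so characteristics need not be
lifted to admissible pairs. -/
theorem exists_local_optimality (hρ : IsPrincipalBundle EM EG EN G ρ)
    (hmax : ∀ p : Cotangent EN N, ∃ r, IsGreatest (fibreValues ρ X₀ p) r)
    (hbdd : ∀ C : Set (Cotangent EN N), IsCompact C → BddAbove (reducedHamiltonian ρ X₀ '' C))
    {a : N → ℝ} (ha : ContMDiff 𝓘(ℝ, EN) 𝓘(ℝ, ℝ) 2 a) {x₀ : N}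
    (hx₀ : differentialAt (E := EN) a x₀ ∈ positiveC2Region (reducedHamiltonian ρ X₀))
    {O : Set N} (hO : O ∈ 𝓝 x₀) :
    ∃ U ∈ 𝓝 x₀, ∃ δ > 0, ∀ ε ∈ Ioo 0 δ,
      (∀ x ∈ U, FlowDefined (reducedHamiltonian ρ X₀) ε (differentialAt (E := EN) a x) ∧
        flowMap (E := EN) (reducedHamiltonian ρ X₀) a ε x ∈ O) ∧
      ContinuousOn (flowMap (E := EN) (reducedHamiltonian ρ X₀) a ε) U ∧
      ∀ y ∈ U, ∃ φ : N → ℝ,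
        φ (flowMap (E := EN) (reducedHamiltonian ρ X₀) a ε y) = a y ∧
        (∃ P : EN →L[ℝ] ℝ, P ≠ 0 ∧ HasMFDerivAt 𝓘(ℝ, EN) 𝓘(ℝ, ℝ) φ
          (flowMap (E := EN) (reducedHamiltonian ρ X₀) a ε y) P) ∧
        (∀ x ∈ U, φ (flowMap (E := EN) (reducedHamiltonian ρ X₀) a ε x) ≤ a x ∧
          (φ (flowMap (E := EN) (reducedHamiltonian ρ X₀) a ε x) = a x → x = y)) ∧
        ∀ (γ : ℝ → M) (u : ℝ → EuclideanSpace ℝ (Fin k)),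
          IsAdmissiblePair (rescaledSystem X₀ (fun i ↦ fundamentalField (ξ i)) ε) γ u →
          ρ (γ 0) ∈ U → φ (ρ (γ 1)) ≤ a (ρ (γ 0)) ∧
            (φ (ρ (γ 1)) = a (ρ (γ 0)) → ρ (γ 0) = y) := by
  set H : Cotangent EN N → ℝ := reducedHamiltonian ρ X₀ with hH
  set ψ := chartAt EN x₀ with hψ
  set Q := cotangentChart EN x₀ with hQ
  set h : EN × (EN →L[ℝ] ℝ) → ℝ := H ∘ Q.symm with hh
  set b : EN → ℝ := a ∘ ψ.symm with hb
  set q₀ := ψ x₀ with hq₀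
  have hsrc : x₀ ∈ ψ.source := mem_chart_source EN x₀
  have htar : q₀ ∈ ψ.target := ψ.map_source hsrc
  have hamd : MDifferentiable 𝓘(ℝ, EN) 𝓘(ℝ, ℝ) a := ha.mdifferentiable (by simp)
  have hbC : ContDiffOn ℝ 2 b ψ.target := ha.contDiffOn_comp_chartAt_symm x₀
  have hba : ContDiffAt ℝ 2 b q₀ := hbC.contDiffAt (ψ.open_target.mem_nhds htar)
  set Z : EN → EN × (EN →L[ℝ] ℝ) := fun q ↦ (q, fderiv ℝ b q) with hZ
  have hQZ : ∀ x ∈ ψ.source, Q (differentialAt (E := EN) a x) = Z (ψ x) := fun x hx ↦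
    cotangentChart_differentialAt (hamd x) hx
  have hQZ' : ∀ x ∈ ψ.source, Q.symm (Z (ψ x)) = differentialAt (E := EN) a x := fun x hx ↦ by
    rw [← hQZ x hx, Q.left_inv (mem_cotangentChart_source.2 hx)]
  have hZc : ContinuousOn Z ψ.target :=
    continuousOn_id.prodMk (hbC.continuousOn_fderiv_of_isOpen ψ.open_target (by simp))
  have hhC : ContDiffAt ℝ 2 h (Z q₀) := by
    have := IsC2At.contDiffAt (x₀ := x₀) hsrc hx₀.2
    rwa [← hQ, hQZ x₀ hsrc] at this
  have hρd := hρ.mdifferentiable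
  have hhom : ∀ q ∈ ψ.target, ∀ (l : EN →L[ℝ] ℝ) (c : ℝ), 0 < c → h (q, c • l) = c * h (q, l) :=
    fun q hq l c hc ↦ reducedHamiltonian_smul hρd hmax hq l c hc
  have hsub : ∀ q ∈ ψ.target, ∀ l m : EN →L[ℝ] ℝ, h (q, l + m) ≤ h (q, l) + h (q, m) :=
    fun q hq l m ↦ reducedHamiltonian_add_le hρd hmax hq l m
  have hpos : 0 < h (Z q₀) := by
    rw [hh, Function.comp_apply, hQZ' x₀ hsrc]
    exact hx₀.1
  -- Homogeneity forces `h (q₀, 0) = 2 * h (q₀, 0)`, so a positive Hamiltonian excludes the zero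
  -- momentum. This nonvanishing, which persists nearby, makes the final differential of `φ`
  -- nonzero.
  have hp0 : (Z q₀).2 ≠ 0 := fun h0 ↦ by
    have h1 := hhom q₀ htar (Z q₀).2 2 two_pos
    rw [h0, smul_zero] at h1
    have h2 : Z q₀ = (q₀, 0) := Prod.ext rfl h0
    rw [h2] at hpos
    linarith
  obtain ⟨Uv, hUv, Ov, hOv, δ₁, hδ₁, hver⟩ := exists_verification_function hba hhC
    (eventually_of_mem (ψ.open_target.mem_nhds htar) hhom)
  have hgood : ∀ᶠ z in 𝓝 (Z q₀), z ∈ Ov ∧ z.2 ≠ 0 ∧ z.1 ∈ ψ.target ∧ IsC2At H (Q.symm z) ∧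
      ψ.symm z.1 ∈ O ∧ z.1 ∈ Uv := by
    have hfst : ContinuousAt (Prod.fst : EN × (EN →L[ℝ] ℝ) → EN) (Z q₀) := continuousAt_fst
    have h1 : ∀ᶠ z in 𝓝 (Z q₀), z.2 ≠ 0 :=
      continuousAt_snd.eventually_ne hp0
    have h2 : ∀ᶠ z in 𝓝 (Z q₀), z.1 ∈ ψ.target :=
      hfst.eventually_mem (ψ.open_target.mem_nhds htar)
    have h3 : ∀ᶠ z in 𝓝 (Z q₀), IsC2At H (Q.symm z) := by
      have h4 : ∀ᶠ p in 𝓝 (differentialAt (E := EN) a x₀), IsC2At H p := by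
        have : IsManifold (cotangentModel EN) 2 (Cotangent EN N) :=
          IsManifold.of_le (n := ∞) (WithTop.coe_le_coe.2 le_top)
        exact (contMDiffAt_iff_contMDiffAt_nhds (by simp)).1 hx₀.2
      have h5 : ContinuousAt Q.symm (Z q₀) :=
        Q.continuousAt_symm (mem_cotangentChart_target.2 htar)
      rw [← hQZ' x₀ hsrc] at h4
      exact h5.eventually h4
    have h6 : ∀ᶠ z in 𝓝 (Z q₀), ψ.symm z.1 ∈ O := by
      have h8 : ContinuousAt ψ.symm (Z q₀).1 := ψ.continuousAt_symm htar
      have h7 : ContinuousAt (fun z : EN × (EN →L[ℝ] ℝ) ↦ ψ.symm z.1) (Z q₀) := h8.comp hfst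
      refine h7.eventually_mem ?_
      change O ∈ 𝓝 (ψ.symm (ψ x₀))
      rwa [ψ.left_inv hsrc]
    filter_upwards [hOv, h1, h2, h3, h6, hfst.eventually_mem hUv] with z z1 z2 z3 z4 z5 z6
    exact ⟨z1, z2, z3, z4, z5, z6⟩
  obtain ⟨Uf, hUf, δ₂, hδ₂, α, hα, hαc⟩ := hhC.hamiltonianField.exists_local_flow hgood
  have hUvO : ψ.source ∩ ψ ⁻¹' Uv ∈ 𝓝 x₀ :=
    inter_mem (ψ.open_source.mem_nhds hsrc) (ψ.continuousAt hsrc hUv)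
  -- Admissible projections starting in `Uc` remain in the chart and in `Uv`, where the verification
  -- inequality applies.
  obtain ⟨Uc, hUc, δ₃, hδ₃, hconf⟩ := exists_confinement (ξ := ξ) hρ hmax hbdd x₀ hUvO
  have hZat : ContinuousAt (fun x ↦ Z (ψ x)) x₀ :=
    (hZc.continuousAt (ψ.open_target.mem_nhds htar)).comp (ψ.continuousAt hsrc)
  refine ⟨(ψ.source ∩ (fun x ↦ Z (ψ x)) ⁻¹' Uf) ∩ Uc,
    inter_mem (inter_mem (ψ.open_source.mem_nhds hsrc) (hZat hUf)) hUc,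
    min δ₁ (min δ₂ δ₃), lt_min hδ₁ (lt_min hδ₂ hδ₃), fun ε hε ↦ ?_⟩
  have hε1 : ε ∈ Ioo 0 δ₁ := ⟨hε.1, hε.2.trans_le (min_le_left _ _)⟩
  have hε2 : ε < δ₂ := hε.2.trans_le ((min_le_right _ _).trans (min_le_left _ _))
  have hε3 : ε ∈ Ioo 0 δ₃ := ⟨hε.1, hε.2.trans_le ((min_le_right _ _).trans (min_le_right _ _))⟩
  have hεI : ε ∈ Icc 0 ε := ⟨hε.1.le, le_rfl⟩
  have h0I : (0 : ℝ) ∈ Icc 0 ε := ⟨le_rfl, hε.1.le⟩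
  set U := (ψ.source ∩ (fun x ↦ Z (ψ x)) ⁻¹' Uf) ∩ Uc with hU
  have hsubI : Icc 0 ε ⊆ Icc 0 δ₂ := Icc_subset_Icc_right hε2.le
  have hβ0 : ∀ x ∈ U, α (Z (ψ x)) 0 = Z (ψ x) := fun x hx ↦ (hα _ hx.1.2).1
  have hβ : ∀ x ∈ U, ∀ t ∈ Icc 0 ε, HasDerivWithinAt (α (Z (ψ x)))
      (hamiltonianField h (α (Z (ψ x)) t)) (Icc 0 ε) t := fun x hx t ht ↦
    ((hα _ hx.1.2).2 t (hsubI ht)).1.mono hsubI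
  have hβO : ∀ x ∈ U, ∀ t ∈ Icc 0 ε, _ := fun x hx t ht ↦
    ((hα _ hx.1.2).2 t (hsubI ht)).2
  have htraj : ∀ x ∈ U, IsHamiltonianTrajectory H ε (Q.symm ∘ α (Z (ψ x))) := fun x hx ↦
    isHamiltonianTrajectory_of_hasDerivWithinAt fun t ht ↦
      ⟨mem_cotangentChart_target.2 (hβO x hx t ht).2.2.1, (hβO x hx t ht).2.2.2.1, hβ x hx t ht⟩
  have hinit : ∀ x ∈ U, (Q.symm ∘ α (Z (ψ x))) 0 = differentialAt (E := EN) a x := fun x hx ↦ by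
    rw [Function.comp_apply, hβ0 x hx, hQZ' x hx.1.1]
  have hflow : ∀ x ∈ U, flowMap (E := EN) H a ε x = ψ.symm (α (Z (ψ x)) ε).1 := fun x hx ↦ by
    rw [flowMap, ← hinit x hx, hamiltonianFlow_eq hε.1.le (htraj x hx), Function.comp_apply,
      cotangentChart_symm_proj (hβO x hx ε hεI).2.2.1]
  refine ⟨fun x hx ↦ ⟨⟨_, htraj x hx, hinit x hx⟩, ?_⟩, ?_, fun y hy ↦ ?_⟩
  · rw [hflow x hx]
    exact (hβO x hx ε hεI).2.2.2.2.1
  · refine ContinuousOn.congr ?_ hflow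
    refine ψ.continuousOn_symm.comp (t := ψ.target) ?_ fun x hx ↦ (hβO x hx ε hεI).2.2.1
    refine ContinuousOn.fst ?_
    refine (hαc ε ⟨hε.1.le, hε2.le⟩).comp (t := Uf) ?_ fun x hx ↦ hx.1.2
    exact (hZc.comp (ψ.continuousOn.mono fun x hx ↦ hx.1.1) fun x hx ↦ ψ.map_source hx.1.1)
  · have hfst0 : ∀ x ∈ U, (α (Z (ψ x)) 0).1 = ψ x := fun x hx ↦ by rw [hβ0 x hx]
    have hax : ∀ x ∈ U, b (ψ x) = a x := fun x hx ↦ by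
      rw [hb, Function.comp_apply, ψ.left_inv hx.1.1]
    obtain ⟨φ, hφ1, hφ2, hφ3⟩ := hver ε hε1 (α (Z (ψ y)))
      (fun t ht ↦ ⟨(hβO y hy t ht).1, hβ y hy t ht⟩) (by rw [hβ0 y hy])
    rw [hfst0 y hy, hax y hy] at hφ1
    have hψΦ : ∀ x ∈ U, ψ (flowMap (E := EN) H a ε x) = (α (Z (ψ x)) ε).1 := fun x hx ↦ by
      rw [hflow x hx, ψ.right_inv (hβO x hx ε hεI).2.2.1]
    have hcompare : ∀ ζ : ℝ → EN, LocallyLipschitzOn (Icc 0 1) ζ →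
        (∀ t ∈ Icc (0 : ℝ) 1, ζ t ∈ Uv) →
        (∀ᵐ t ∂volume.restrict (Icc (0 : ℝ) 1), ∃ v, HasDerivAt ζ v t ∧
          ∀ l : EN →L[ℝ] ℝ, l v ≤ ε * h (ζ t, l)) → ∀ x ∈ U, ζ 0 = ψ x →
        φ (ζ 1) ≤ a x ∧ (φ (ζ 1) = a x → x = y) := by
      intro ζ h1 h2 h3 x hx h4
      have h5 := hφ3 ζ h1 h2 h3
      rw [h4, hax x hx, hfst0 y hy] at h5
      exact ⟨h5.1, fun h6 ↦ ψ.injOn hx.1.1 hy.1.1 (h5.2 h6)⟩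
    refine ⟨φ ∘ ψ, ?_, ?_, fun x hx ↦ ?_, fun γ u hγ h0 ↦ ?_⟩
    · rw [Function.comp_apply, hψΦ y hy, hφ1]
    · refine exists_hasMFDerivAt_comp_chartAt ?_ ?_ (hβO y hy ε hεI).2.1
      · rw [hflow y hy]
        exact ψ.map_target (hβO y hy ε hεI).2.2.1
      · rwa [hψΦ y hy]
    · rw [Function.comp_apply, hψΦ x hx]
      have hCβ : ∀ t ∈ Icc 0 ε, ContDiffAt ℝ 2 h (α (Z (ψ x)) t) := fun t ht ↦ by
        have ht' := mem_cotangentChart_target.2 (hβO x hx t ht).2.2.1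
        have := IsC2At.contDiffAt (mem_cotangentChart_source.1 (Q.map_target ht'))
          (hβO x hx t ht).2.2.2.1
        rwa [Q.right_inv ht'] at this
      obtain ⟨h1, h2⟩ := characteristic_dominated hε.1 hCβ (hβ x hx)
        (fun t ht ↦ hhom _ (hβO x hx t ht).2.2.1) (fun t ht ↦ hsub _ (hβO x hx t ht).2.2.1)
      have h3 := hcompare _ h1 (fun t ht ↦ (hβO x hx (ε * t)
        ⟨mul_nonneg hε.1.le ht.1, mul_le_of_le_one_right hε.1.le ht.2⟩).2.2.2.2.2) h2 x hx
        (by rw [mul_zero, hfst0 x hx])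
      simpa only [mul_one] using h3
    · have hin := hconf ε hε3 γ u hγ h0.2
      refine hcompare (fun t ↦ ψ (ρ (γ t)))
        (hγ.locallyLipschitzOn_chart hρ subset_rfl fun t ht ↦ (hin t ht).1)
        (fun t ht ↦ (hin t ht).2) ?_ _ h0 rfl
      filter_upwards [hγ.ae_hasDerivAt_chart hρ x₀, ae_restrict_mem measurableSet_Icc]
        with t hd ht
      refine ⟨_, hd (hin t ht).1, fun l ↦ ?_⟩
      rw [map_smul, smul_eq_mul]
      exact mul_le_mul_of_nonneg_left (apply_chartDrift_le hρd hmax (hin t ht).1 l) hε.1.le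

end LocalOptimality

/-! ## Singular trajectories -/

section Singular

variable {EM EG EN : Type*}
    [NormedAddCommGroup EM] [NormedSpace ℝ EM]
    [NormedAddCommGroup EG] [NormedSpace ℝ EG]
    [NormedAddCommGroup EN] [NormedSpace ℝ EN]
    {M : Type*} [TopologicalSpace M] [ChartedSpace EM M]
    {N : Type*} [TopologicalSpace N] [ChartedSpace EN N]
    {G : Type*} [TopologicalSpace G] [ChartedSpace EG G] [CommGroup G] [MulAction G M]
    {ρ : M → N} {k : ℕ}

/-- The projection of a principal bundle is a submersion. -/
theorem IsPrincipalBundle.chartDeriv_surjective (hρ : IsPrincipalBundle EM EG EN G ρ) (y : M) :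
    Function.Surjective (chartDeriv EM EN ρ y) := by
  obtain ⟨e, he, -, hsymm, -⟩ := hρ.locally_trivial (ρ y)
  have hy : y ∈ e.source := e.mem_source.2 he
  set g := (e y).2
  have hey : (ρ y, g) = e y := Prod.ext (e.coe_fst hy).symm rfl
  have htar : (ρ y, g) ∈ e.target := hey ▸ e.map_source hy
  have hσy : e.toOpenPartialHomeomorph.symm (ρ y, g) = y := by
    rw [hey]
    exact e.left_inv hy
  have hσ : ContMDiffAt 𝓘(ℝ, EN) 𝓘(ℝ, EM) ∞
      (fun x ↦ e.toOpenPartialHomeomorph.symm (x, g)) (ρ y) :=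
    ContMDiffAt.comp (ρ y) (hsymm.contMDiffAt (e.open_target.mem_nhds htar))
      (contMDiffAt_id.prodMk contMDiffAt_const)
  have h1 : HasMFDerivAt 𝓘(ℝ, EM) 𝓘(ℝ, EN) ρ (e.toOpenPartialHomeomorph.symm (ρ y, g))
      (chartDeriv EM EN ρ y) := by
    rw [hσy]
    exact hasMFDerivAt_chartDeriv (hρ.mdifferentiable y)
  have h2 := HasMFDerivAt.comp (ρ y) h1
    (hasMFDerivAt_chartDeriv (hσ.mdifferentiableAt (by simp)))
  have h3 : (ρ ∘ fun x ↦ e.toOpenPartialHomeomorph.symm (x, g)) =ᶠ[𝓝 (ρ y)] id := by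
    filter_upwards [e.open_baseSet.mem_nhds he] with x hx
    exact e.proj_symm_apply (e.mem_target.2 hx)
  have h4 := hasMFDerivAt_unique h2 ((hasMFDerivAt_id (ρ y)).congr_of_eventuallyEq h3)
  intro v
  exact ⟨_, congrArg (fun L : EN →L[ℝ] EN ↦ L v) h4⟩

/-- An admissible pair whose endpoint maximizes a noncritical function of the base point is
singular. -/
theorem isSingular_of_forall_le (hρ : IsPrincipalBundle EM EG EN G ρ)
    {F : ∀ y : M, EuclideanSpace ℝ (Fin k) → TangentSpace 𝓘(ℝ, EM) y}
    {γ : ℝ → M} {u : ℝ → EuclideanSpace ℝ (Fin k)} {φ : N → ℝ} {P : EN →L[ℝ] ℝ} (hP : P ≠ 0)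
    (hφ : HasMFDerivAt 𝓘(ℝ, EN) 𝓘(ℝ, ℝ) φ (ρ (γ 1)) P)
    (hle : ∀ (γ' : ℝ → M) (u' : ℝ → EuclideanSpace ℝ (Fin k)), IsAdmissiblePair F γ' u' →
      γ' 0 = γ 0 → φ (ρ (γ' 1)) ≤ φ (ρ (γ 1))) :
    IsSingular F γ u := by
  have hkey : ∀ w : EM, w ∈ endpointVariations F γ u → P (chartDeriv EM EN ρ (γ 1) w) = 0 := by
    rintro w ⟨v, Γ, -, rfl, hadm, hd⟩
    have h1 : HasMFDerivAt 𝓘(ℝ, EM) 𝓘(ℝ, EN) ρ (Γ 0 1) (chartDeriv EM EN ρ (Γ 0 1)) :=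
      hasMFDerivAt_chartDeriv (hρ.mdifferentiable _)
    have h2 := HasMFDerivAt.comp (0 : ℝ) (HasMFDerivAt.comp (Γ 0 1) hφ h1) hd
    have h3 : HasFDerivAt (fun s ↦ φ (ρ (Γ s 1)))
        ((P.comp (chartDeriv EM EN ρ (Γ 0 1))).comp ((1 : ℝ →L[ℝ] ℝ).smulRight w)) 0 :=
      h2.hasFDerivAt
    -- For small `s` the varied paths are admissible from the same initial point, hence competitors.
    -- The derivative along each variation vanishes, so all variations lie in the kernel of the
    -- nonzero functional `P ∘ dρ`.
    have hmax : IsLocalMax (fun s ↦ φ (ρ (Γ s 1))) 0 := by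
      filter_upwards [hadm] with s hs
      exact hle _ _ hs.1 hs.2
    have h4 := hmax.hasFDerivAt_eq_zero h3
    have h5 := congrArg (fun L : ℝ →L[ℝ] ℝ ↦ L 1) h4
    simpa using h5
  intro htop
  have hspan : Submodule.span ℝ (endpointVariations F γ u) ≤
      LinearMap.ker ((P.comp (chartDeriv EM EN ρ (γ 1)) : EM →L[ℝ] ℝ) : EM →ₗ[ℝ] ℝ) :=
    Submodule.span_le.2 fun w hw ↦ hkey w hw
  rw [htop] at hspan
  refine hP (ContinuousLinearMap.ext fun v ↦ ?_)
  obtain ⟨w, rfl⟩ := hρ.chartDeriv_surjective (γ 1) v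
  exact hspan (Submodule.mem_top (x := w))

end Singular

/-! ## Optimality over a compact set -/

section GlobalOptimality

/-- The intervals `Ioo 0 δ` shrink with `δ`, so finitely many local thresholds are replaced by their
minimum. -/
theorem IsCompact.exists_forall_Ioo {X : Type*} [TopologicalSpace X] {K : Set X}
    (hK : IsCompact K) {p : ℝ → X → Prop}
    (hp : ∀ x ∈ K, ∃ U ∈ 𝓝 x, ∃ δ > 0, ∀ ε ∈ Ioo 0 δ, ∀ x' ∈ U, p ε x') :
    ∃ δ > 0, ∀ ε ∈ Ioo 0 δ, ∀ x ∈ K, p ε x := by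
  refine hK.induction_on (p := fun s ↦ ∃ δ > 0, ∀ ε ∈ Ioo 0 δ, ∀ x ∈ s, p ε x)
    ⟨1, one_pos, fun _ _ _ h ↦ h.elim⟩ ?_ ?_ ?_
  · rintro s t hst ⟨δ, hδ, h⟩
    exact ⟨δ, hδ, fun ε hε x hx ↦ h ε hε x (hst hx)⟩
  · rintro s t ⟨δ, hδ, h⟩ ⟨δ', hδ', h'⟩
    refine ⟨min δ δ', lt_min hδ hδ', fun ε hε x hx ↦ ?_⟩
    rcases hx with hx | hx
    · exact h ε ⟨hε.1, hε.2.trans_le (min_le_left _ _)⟩ x hx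
    · exact h' ε ⟨hε.1, hε.2.trans_le (min_le_right _ _)⟩ x hx
  · intro x hx
    obtain ⟨U, hU, h⟩ := hp x hx
    exact ⟨U, mem_nhdsWithin_of_mem_nhds hU, h⟩

variable {EM EG EN : Type*}
    [NormedAddCommGroup EM] [NormedSpace ℝ EM]
    [NormedAddCommGroup EG] [NormedSpace ℝ EG]
    [NormedAddCommGroup EN] [NormedSpace ℝ EN] [FiniteDimensional ℝ EN]
    {M : Type*} [TopologicalSpace M] [ChartedSpace EM M]
    {N : Type*} [TopologicalSpace N] [T2Space N]
    [ChartedSpace EN N] [IsManifold 𝓘(ℝ, EN) ∞ N]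
    {G : Type*} [TopologicalSpace G] [ChartedSpace EG G] [CommGroup G] [MulAction G M]
    {ρ : M → N} {k : ℕ} {ξ : Fin k → TangentSpace 𝓘(ℝ, EG) (1 : G)}
    {X₀ : ∀ y : M, TangentSpace 𝓘(ℝ, EM) y}

variable (EN ρ ξ X₀) in
/-- The optimality properties of the projected characteristics starting from `x` and `y`. -/
structure CharacteristicOptimality (a : N → ℝ) (ε : ℝ) (x y : N) : Prop where
  flowDefined : FlowDefined (reducedHamiltonian ρ X₀) ε (differentialAt (E := EN) a x)
  continuousAt : ContinuousAt (flowMap (E := EN) (reducedHamiltonian ρ X₀) a ε) x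
  injective : flowMap (E := EN) (reducedHamiltonian ρ X₀) a ε x =
    flowMap (E := EN) (reducedHamiltonian ρ X₀) a ε y → x = y
  optimal : ∀ (γ : ℝ → M) (u : ℝ → EuclideanSpace ℝ (Fin k)),
    IsAdmissiblePair (rescaledSystem X₀ (fun i ↦ fundamentalField (ξ i)) ε) γ u →
    ρ (γ 0) = x → ρ (γ 1) = flowMap (E := EN) (reducedHamiltonian ρ X₀) a ε y →
    a y ≤ a x ∧ (a y = a x → x = y)
  singular : ∀ (γ : ℝ → M) (u : ℝ → EuclideanSpace ℝ (Fin k)),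
    IsAdmissiblePair (rescaledSystem X₀ (fun i ↦ fundamentalField (ξ i)) ε) γ u →
    x = y → ρ (γ 0) = x → ρ (γ 1) = flowMap (E := EN) (reducedHamiltonian ρ X₀) a ε y →
    IsSingular (rescaledSystem X₀ (fun i ↦ fundamentalField (ξ i)) ε) γ u

/-- Compactness is applied to pairs of starting points. Near the diagonal the verification functions
decide; away from it, curves issued from the two points stay in disjoint open sets for small `ε`. -/
theorem exists_characteristicOptimality (hρ : IsPrincipalBundle EM EG EN G ρ)
    (hmax : ∀ p : Cotangent EN N, ∃ r, IsGreatest (fibreValues ρ X₀ p) r)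
    (hbdd : ∀ C : Set (Cotangent EN N), IsCompact C → BddAbove (reducedHamiltonian ρ X₀ '' C))
    {K : Set N} (hK : IsCompact K) {a : N → ℝ} (ha : ContMDiff 𝓘(ℝ, EN) 𝓘(ℝ, ℝ) 2 a)
    (haK : ∀ x ∈ K,
      differentialAt (E := EN) a x ∈ positiveC2Region (reducedHamiltonian ρ X₀)) :
    ∃ δ > 0, ∀ ε ∈ Ioo 0 δ, ∀ z ∈ K ×ˢ K,
      CharacteristicOptimality EN ρ ξ X₀ a ε z.1 z.2 := by
  refine (hK.prod hK).exists_forall_Ioo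
    (p := fun ε z ↦ CharacteristicOptimality EN ρ ξ X₀ a ε z.1 z.2) ?_
  rintro ⟨x₀, y₀⟩ ⟨hx₀, hy₀⟩
  by_cases hxy : x₀ = y₀
  · subst hxy
    obtain ⟨U, hU, δ, hδ, h⟩ := exists_local_optimality (ξ := ξ) hρ hmax hbdd ha (haK x₀ hx₀)
      univ_mem
    refine ⟨interior U ×ˢ interior U, prod_mem_nhds (interior_mem_nhds.2 hU)
      (interior_mem_nhds.2 hU), δ, hδ, fun ε hε ⟨x, y⟩ ⟨hx, hy⟩ ↦ ?_⟩
    obtain ⟨hflow, hcont, hopt⟩ := h ε hε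
    have hxU := interior_subset hx
    have hyU := interior_subset hy
    refine ⟨(hflow x hxU).1, hcont.continuousAt (mem_interior_iff_mem_nhds.1 hx), fun heq ↦ ?_,
      fun γ u hγ h0 h1 ↦ ?_, fun γ u hγ hxy h0 h1 ↦ ?_⟩
    -- If the endpoints coincide, the function attached to `y` gives `a y ≤ a x` and the one
    -- attached to `x` gives `a x ≤ a y`; the equality case then gives `x = y`.
    · obtain ⟨φ, hφ, -, h2, -⟩ := hopt y hyU
      obtain ⟨φ', hφ', -, h2', -⟩ := hopt x hxU
      have h3 := h2 x hxU
      have h4 := (h2' y hyU).1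
      change flowMap (E := EN) (reducedHamiltonian ρ X₀) a ε x =
        flowMap (E := EN) (reducedHamiltonian ρ X₀) a ε y at heq
      rw [heq, hφ] at h3
      rw [← heq, hφ'] at h4
      exact h3.2 (le_antisymm h3.1 h4)
    · obtain ⟨φ, hφ, -, -, h2⟩ := hopt y hyU
      change ρ (γ 0) = x at h0
      have h3 := h2 γ u hγ (h0 ▸ hxU)
      rwa [h1, hφ, h0] at h3
    · obtain ⟨φ, hφ, ⟨P, hP, hd⟩, -, h2⟩ := hopt y hyU
      change x = y at hxy
      change ρ (γ 0) = x at h0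
      change ρ (γ 1) = flowMap (E := EN) (reducedHamiltonian ρ X₀) a ε y at h1
      rw [← h1] at hd
      refine isSingular_of_forall_le hρ hP hd fun γ' u' hγ' h0' ↦ ?_
      have h3 := (h2 γ' u' hγ' (by rwa [h0', h0])).1
      rwa [h0', h0, hxy, ← hφ, ← h1] at h3
  · obtain ⟨Ox, Oy, hOx, hOy, hxO, hyO, hdisj⟩ := t2_separation hxy
    obtain ⟨Ux, hUx, δ, hδ, h⟩ := exists_local_optimality (ξ := ξ) hρ hmax hbdd ha (haK x₀ hx₀)
      -- The endpoint from `x` is kept in `Ox` and the one from `y` in `Oy`, and admissible curves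
      -- from `x` stay in `Ox`: the last three clauses then have contradictory hypotheses.
      (hOx.mem_nhds hxO)
    obtain ⟨Uy, hUy, δ', hδ', h'⟩ := exists_local_optimality (ξ := ξ) hρ hmax hbdd ha
      (haK y₀ hy₀) (hOy.mem_nhds hyO)
    obtain ⟨Uc, hUc, δ'', hδ'', hc⟩ := exists_confinement (ξ := ξ) hρ hmax hbdd x₀
      (hOx.mem_nhds hxO)
    refine ⟨(interior Ux ∩ Uc ∩ Ox) ×ˢ (Uy ∩ Oy), prod_mem_nhds
      (inter_mem (inter_mem (interior_mem_nhds.2 hUx) hUc) (hOx.mem_nhds hxO))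
      (inter_mem hUy (hOy.mem_nhds hyO)), min δ (min δ' δ''), lt_min hδ (lt_min hδ' hδ''),
      fun ε hε ⟨x, y⟩ ⟨⟨⟨hx, hxc⟩, hxO⟩, ⟨hy, hyO⟩⟩ ↦ ?_⟩
    obtain ⟨hflow, hcont, -⟩ := h ε ⟨hε.1, hε.2.trans_le (min_le_left _ _)⟩
    obtain ⟨hflow', -, -⟩ := h' ε
      ⟨hε.1, hε.2.trans_le ((min_le_right _ _).trans (min_le_left _ _))⟩
    have hxU := interior_subset hx
    have hne : ∀ {x' y'}, x' ∈ Ox → y' ∈ Oy → x' ≠ y' := fun h1 h2 ↦ hdisj.ne_of_mem h1 h2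
    refine ⟨(hflow x hxU).1, hcont.continuousAt (mem_interior_iff_mem_nhds.1 hx),
      fun heq ↦ (hne (hflow x hxU).2 (hflow' y hy).2 heq).elim,
      fun γ u hγ h0 h1 ↦ ?_, fun γ u hγ hxy ↦ (hne hxO hyO hxy).elim⟩
    change ρ (γ 0) = x at h0
    have h2 := hc ε ⟨hε.1, hε.2.trans_le ((min_le_right _ _).trans (min_le_right _ _))⟩ γ u hγ
      (h0 ▸ hxc) 1 (right_mem_Icc.2 zero_le_one)
    exact (hne h2 (hflow' y hy).2 h1).elim

end GlobalOptimality

/-! ## Transport maps -/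

section TransportMaps

/-- A map whose total cost is less than `+∞` has finite pointwise cost almost everywhere. -/
theorem ae_lt_top_of_totalCost_lt_top {M : Type*} [MeasurableSpace M] {c : M → M → EReal}
    {μ : Measure M} {Ψ : M → M} (h : totalCost c μ Ψ < ⊤) : ∀ᵐ y ∂μ, c y (Ψ y) < ⊤ := by
  have hfin : positiveIntegral μ (fun x ↦ c x (Ψ x)) < ⊤ := by
    refine lt_top_iff_ne_top.2 fun h0 ↦ h.ne ?_
    rw [totalCost, if_pos h0]
  obtain ⟨g, hg⟩ := iInf_lt_iff.1 hfin
  obtain ⟨⟨hgm, hcg⟩, hlt⟩ := iInf_lt_iff.1 hg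
  filter_upwards [ae_lt_top hgm hlt.ne] with y hy
  refine lt_top_iff_ne_top.2 fun h0 ↦ ?_
  have hc : (c y (Ψ y)).toENNReal < ⊤ := (hcg y).trans_lt hy
  rw [h0] at hc
  simp at hc

theorem exists_isAdmissiblePair_of_controlCost_lt_top {EM : Type*} [NormedAddCommGroup EM]
    [NormedSpace ℝ EM] {M : Type*} [TopologicalSpace M] [ChartedSpace EM M] {k : ℕ}
    {F : ∀ y : M, EuclideanSpace ℝ (Fin k) → TangentSpace 𝓘(ℝ, EM) y}
    {L : M × EuclideanSpace ℝ (Fin k) → ℝ} {y₀ y₁ : M} (h : controlCost F L y₀ y₁ < ⊤) :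
    ∃ γ u, IsAdmissiblePair F γ u ∧ γ 0 = y₀ ∧ γ 1 = y₁ := by
  obtain ⟨γ, h⟩ := iInf_lt_iff.1 h
  obtain ⟨u, h⟩ := iInf_lt_iff.1 h
  obtain ⟨h, -⟩ := iInf_lt_iff.1 h
  exact ⟨γ, u, h⟩

/-- Let `Φ` transport the law of `f` to the law of `g`, and suppose that `a x ≤ a (f y)` whenever
`g y = Φ x`, with equality only if `x = f y`. Then `g = Φ ∘ f` almost everywhere. -/
theorem ae_eq_of_potential {M N : Type*} [MeasurableSpace M] [TopologicalSpace N] [T2Space N]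
    [SecondCountableTopology N] [MeasurableSpace N] [BorelSpace N] {μ : Measure M}
    [IsFiniteMeasure μ] {f g : M → N} (hf : Measurable f) (hg : Measurable g) {K : Set N}
    (hK : IsCompact K) (hfK : ∀ᵐ y ∂μ, f y ∈ K) {Φ : N → N} (hΦ : ContinuousOn Φ K)
    (hinj : InjOn Φ K) (hmap : μ.map g = (μ.map f).map Φ) {a : N → ℝ} (ha : ContinuousOn a K)
    (hle : ∀ᵐ y ∂μ, ∀ x ∈ K, g y = Φ x → a x ≤ a (f y) ∧ (a x = a (f y) → f y = x)) :
    ∀ᵐ y ∂μ, g y = Φ (f y) := by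
  have hKm : MeasurableSet K := hK.isClosed.measurableSet
  have hres : (μ.map f).restrict K = μ.map f :=
    Measure.restrict_eq_self_of_ae_mem ((ae_map_iff hf.aemeasurable hKm).2 hfK)
  have hΦm : AEMeasurable Φ (μ.map f) := hres ▸ hΦ.aemeasurable hKm
  have ham : AEMeasurable a (μ.map f) := hres ▸ ha.aemeasurable hKm
  have : CompactSpace K := isCompact_iff_compactSpace.1 hK
  -- A continuous injection of a compact space into a Hausdorff one is a closed embedding, so `a ∘
  -- Φ⁻¹` on `Φ '' K` extends to a measurable function `b` on `N`.
  have hemb : MeasurableEmbedding (K.domRestrict Φ) :=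
    (Continuous.isClosedEmbedding hΦ.domRestrict hinj.injective).measurableEmbedding
  obtain ⟨b, hbm, hb⟩ := hemb.exists_measurable_extend (g := K.domRestrict a)
    ha.domRestrict.measurable (fun _ ↦ inferInstance)
  have hbΦ : ∀ x ∈ K, b (Φ x) = a x := fun x hx ↦ congrFun hb ⟨x, hx⟩
  have himage : ∀ᵐ y ∂μ, g y ∈ Φ '' K := by
    have hm : MeasurableSet (Φ '' K) := (hK.image_of_continuousOn hΦ).isClosed.measurableSet
    refine (ae_map_iff hg.aemeasurable hm).1 ?_
    rw [hmap, ae_map_iff hΦm hm, ← hres]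
    exact ae_restrict_of_forall_mem hKm fun x hx ↦ mem_image_of_mem Φ hx
  have hint : Integrable a (μ.map f) := by
    obtain ⟨C, hC⟩ := hK.exists_bound_of_continuousOn ha
    refine Integrable.of_bound ham.aestronglyMeasurable C ?_
    rw [← hres]
    exact ae_restrict_of_forall_mem hKm hC
  have hae : (b ∘ Φ) =ᵐ[μ.map f] a := by
    rw [← hres]
    exact ae_restrict_of_forall_mem hKm hbΦ
  have hintb : Integrable b (μ.map g) := by
    rw [hmap, integrable_map_measure hbm.aestronglyMeasurable hΦm]
    exact hint.congr hae.symm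
  have h1 : Integrable (b ∘ g) μ :=
    (integrable_map_measure hbm.aestronglyMeasurable hg.aemeasurable).1 hintb
  have h2 : Integrable (a ∘ f) μ :=
    (integrable_map_measure ham.aestronglyMeasurable hf.aemeasurable).1 hint
  have hba : ∀ᵐ y ∂μ, b (g y) ≤ a (f y) := by
    filter_upwards [hle, himage] with y hy ⟨x, hx, hxy⟩
    rw [← hxy, hbΦ x hx]
    exact (hy x hx hxy.symm).1
  -- Both integrals equal the integral of `a` against the law of `f`, since `b ∘ Φ = a` almost
  -- everywhere for it. With the pointwise inequality this forces equality almost everywhere.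
  have heq : ∫ y, b (g y) ∂μ = ∫ y, a (f y) ∂μ := by
    rw [← integral_map hg.aemeasurable hbm.aestronglyMeasurable,
      ← integral_map hf.aemeasurable ham.aestronglyMeasurable, hmap,
      integral_map hΦm hbm.aestronglyMeasurable]
    exact integral_congr_ae hae
  have hfin := (integral_eq_iff_of_ae_le h1 h2 hba).1 heq
  filter_upwards [hfin, hle, himage] with y hy1 hy2 ⟨x, hx, hxy⟩
  have h3 : a x = a (f y) := by
    rw [← hbΦ x hx, hxy]
    exact hy1
  rw [(hy2 x hx hxy.symm).2 h3, hxy]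

end TransportMaps

end

/-! ### Conclusion: from characteristics to optimal maps -/

theorem mainTheorem6
    {EM EG EN : Type*}
    [NormedAddCommGroup EM] [NormedSpace ℝ EM] [FiniteDimensional ℝ EM]
    [NormedAddCommGroup EG] [NormedSpace ℝ EG] [FiniteDimensional ℝ EG]
    [NormedAddCommGroup EN] [NormedSpace ℝ EN] [FiniteDimensional ℝ EN]
    {M : Type*} [TopologicalSpace M] [T2Space M] [SecondCountableTopology M]
    [ChartedSpace EM M] [IsManifold 𝓘(ℝ, EM) ∞ M] [MeasurableSpace M] [BorelSpace M]
    {N : Type*} [TopologicalSpace N] [T2Space N] [SecondCountableTopology N]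
    [ChartedSpace EN N] [IsManifold 𝓘(ℝ, EN) ∞ N] [MeasurableSpace N] [BorelSpace N]
    {G : Type*} [TopologicalSpace G] [ChartedSpace EG G] [CommGroup G]
    [LieGroup 𝓘(ℝ, EG) ∞ G] [ConnectedSpace G] [MulAction G M]
    (ρ : M → N) (hρ : IsPrincipalBundle EM EG EN G ρ)
    {k : ℕ} (ξ : Fin k → TangentSpace 𝓘(ℝ, EG) (1 : G))
    (hξ : Submodule.span ℝ (range ξ) = ⊤)
    (X₀ : ∀ y : M, TangentSpace 𝓘(ℝ, EM) y)
    (hX₀ : ContMDiff 𝓘(ℝ, EM) (𝓘(ℝ, EM)).tangent ∞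
      (fun y ↦ (⟨y, X₀ y⟩ : TangentBundle 𝓘(ℝ, EM) M)))
    (hmax : ∀ p : Cotangent EN N, ∃ r, IsGreatest (fibreValues ρ X₀ p) r)
    (hbdd : ∀ C : Set (Cotangent EN N), IsCompact C → BddAbove (reducedHamiltonian ρ X₀ '' C))
    (K : Set N) (hK : IsCompact K)
    (a : N → ℝ) (ha : ContMDiff 𝓘(ℝ, EN) 𝓘(ℝ, ℝ) 2 a)
    (haK : ∀ x ∈ K,
      differentialAt (E := EN) a x ∈ positiveC2Region (reducedHamiltonian ρ X₀)) :
    ∃ ε₀ > (0 : ℝ), ∀ ε ∈ Ioo 0 ε₀,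
      (∀ x ∈ K, FlowDefined (reducedHamiltonian ρ X₀) ε (differentialAt (E := EN) a x)) ∧
      ∀ (μ ν : Measure M) [IsProbabilityMeasure μ] [IsProbabilityMeasure ν],
        (μ.map ρ).support ⊆ K →
        ν.map ρ = (μ.map ρ).map (flowMap (E := EN) (reducedHamiltonian ρ X₀) a ε) →
        ∀ L : M × EuclideanSpace ℝ (Fin k) → ℝ,
          ContMDiff ((𝓘(ℝ, EM)).prod 𝓘(ℝ, EuclideanSpace ℝ (Fin k))) 𝓘(ℝ, ℝ) ∞ L →
          ∀ Ψ : M → M,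
            IsOptimalMap
              (controlCost (rescaledSystem X₀ (fun i ↦ fundamentalField (ξ i)) ε) L) μ ν Ψ →
            (∀ᵐ y ∂μ, ρ (Ψ y) = flowMap (E := EN) (reducedHamiltonian ρ X₀) a ε (ρ y)) ∧
            (∀ᵐ y ∂μ,
              (∃ γ u, IsAdmissiblePair
                (rescaledSystem X₀ (fun i ↦ fundamentalField (ξ i)) ε) γ u ∧
                γ 0 = y ∧ γ 1 = Ψ y) ∧
              ∀ γ u, IsAdmissiblePair
                (rescaledSystem X₀ (fun i ↦ fundamentalField (ξ i)) ε) γ u →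
                γ 0 = y → γ 1 = Ψ y →
                IsSingular (rescaledSystem X₀ (fun i ↦ fundamentalField (ξ i)) ε) γ u) := by
  obtain ⟨ε₀, hε₀, h⟩ := exists_characteristicOptimality (ξ := ξ) hρ hmax hbdd hK ha haK
  refine ⟨ε₀, hε₀, fun ε hε ↦ ⟨fun x hx ↦ (h ε hε (x, x) ⟨hx, hx⟩).flowDefined, ?_⟩⟩
  intro μ ν _ _ hsupp hmap L _ Ψ hΨ
  have hρm : Measurable ρ := hρ.contMDiff_proj.continuous.measurable
  have hK' : ∀ᵐ y ∂μ, ρ y ∈ K :=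
    ae_of_ae_map hρm.aemeasurable (mem_of_superset Measure.support_mem_ae hsupp)
  have hadm : ∀ᵐ y ∂μ, ∃ γ u, IsAdmissiblePair
      (rescaledSystem X₀ (fun i ↦ fundamentalField (ξ i)) ε) γ u ∧ γ 0 = y ∧ γ 1 = Ψ y := by
    filter_upwards [ae_lt_top_of_totalCost_lt_top hΨ.cost_lt_top] with y hy
    exact exists_isAdmissiblePair_of_controlCost_lt_top hy
  have hmap' : μ.map (ρ ∘ Ψ) =
      (μ.map ρ).map (flowMap (E := EN) (reducedHamiltonian ρ X₀) a ε) := by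
    rw [← Measure.map_map hρm hΨ.measurable, hΨ.map_eq, hmap]
  have heq : ∀ᵐ y ∂μ, (ρ ∘ Ψ) y = flowMap (E := EN) (reducedHamiltonian ρ X₀) a ε (ρ y) := by
    refine ae_eq_of_potential hρm (hρm.comp hΨ.measurable) hK hK'
      (fun x hx ↦ (h ε hε (x, x) ⟨hx, hx⟩).continuousAt.continuousWithinAt)
      (fun x hx y hy ↦ (h ε hε (x, y) ⟨hx, hy⟩).injective) hmap' ha.continuous.continuousOn ?_
    -- Here `x` is a point of `K` whose characteristic ends at `ρ (Ψ y)`. The admissible pair from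
    -- `y` to `Ψ y` projects to a curve from `ρ y` to that end, so the pair to use is `(ρ y, x)`.
    filter_upwards [hadm, hK'] with y ⟨γ, u, hγ, h0, h1⟩ hy x hx hxy
    exact (h ε hε (ρ y, x) ⟨hy, hx⟩).optimal γ u hγ (congrArg ρ h0) (h1 ▸ hxy)
  refine ⟨heq, ?_⟩
  filter_upwards [heq, hadm, hK'] with y hy hex hyK
  exact ⟨hex, fun γ u hγ h0 h1 ↦ (h ε hε (ρ y, ρ y) ⟨hyK, hyK⟩).singular γ u hγ rfl
    (congrArg ρ h0) (h1 ▸ hy)⟩
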